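/- Notation. A partition is identified with its Young diagram; the hook of a box consists of the box, the boxes to its right in the same row and the boxes below it in the same column. For an integer $n\ge 0$ let $\mathcal E_n$ be the set of $3$-core partitions of $n$ (partitions of $n$ with no hook of length $3$) and $a_3(n)=|\mathcal E_n|$. For a partition $\lambda$, let $\mathcal A_\lambda$ (the arms), respectively $\mathcal L_\lambda$ (the legs), be the set of the numbers of boxes to the right of, respectively below, the diagonal boxes of $\lambda$. If $\lambda$ is a $3$-core, its characteristic vector $c_\lambda=(c_0,c_1,c_2)\in\mathbb Z^3$ is defined as follows: $c_i$ is the number of arms congruent to $i$ modulo $3$ if no leg is congruent to $2-i$ modulo $3$, and otherwise $-c_i$ is the number of legs congruent to $2-i$ modulo $3$. Identify $(x,y)\in\mathbb Z^2$ with $(-x-y,x,y)$, and let $\mathcal C_n\subset\mathbb Z^2$ be the set of characteristic vectors of the elements of $\mathcal E_n$. Let $\mathcal U_k=\{(x,y)\in\mathbb Z^2: x^2+3y^2=k\}$ and $\vartheta(x,y)=(6x+3y+1,\,3y+1)$. Let $\mathcal R=\mathbb Z[\mathbf j]\subset\mathbb C$ with $\mathbf j=e^{2i\pi/3}$, with norm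 $\mathcal N(z)=z\overline z$; the norm of an ideal $I$ is $|\mathcal R/I|$. Let $\nu_p$ be the $p$-adic valuation and let $\Pi_r$ be the set of primes congruent to $r$ modulo $3$. Put $\mathcal V_n=\prod_{p\in\Pi_1}\{0,1,\dots,\nu_p(3n+1)\}$. Theorem. Let $n\ge 0$ be an integer. (1) $\mathcal U_{12n+4}$ is nonempty if and only if $\nu_p(3n+1)$ is even for every $p\in\Pi_2$. (2) $\vartheta$ restricts to a well-defined injective map $\mathcal C_n\to\mathcal U_{12n+4}$. Moreover, for every $p\in\Pi_1$ there is an irreducible $x_p\in\mathcal R$ with $\mathcal N(x_p)=p$. (3) Suppose that $\nu_p(3n+1)$ is even for every $p\in\Pi_2$. For each $p\in\Pi_1$ let $x_p\in\mathcal R$ be any irreducible element with $\mathcal N(x_p)=p$, and for $\underline j=(j_p)\in\mathcal V_n$ set $$q_n=\prod_{p\in\Pi_2}p^{\frac12\nu_p(3n+1)},\qquad y_{\underline j}=q_n\prod_{p\in\Pi_1}x_p^{\,j_p}\,\overline{x_p}^{\,\nu_p(3n+1)-j_p}.$$ Then there are units $\xi_{\underline j}\in\mathcal R^\times$ and integers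 $u_{\underline j}\equiv v_{\underline j}\equiv 1\pmod 3$, for $\underline j\in\mathcal V_n$, such that $$\xi_{\underline j}\,y_{\underline j}=\tfrac12\bigl(u_{\underline j}+v_{\underline j}\sqrt{-3}\bigr)\quad(\underline j\in\mathcal V_n),\qquad \mathcal C_n=\{\vartheta^{-1}(u_{\underline j},v_{\underline j}) : \underline j\in\mathcal V_n\},$$ each $(u_{\underline j},v_{\underline j})$ lying in $\vartheta(\mathcal C_n)$, and there is a bijection $\mathcal V_n\to\mathcal E_n$ sending $\underline j$ to a $3$-core with characteristic vector $\vartheta^{-1}(u_{\underline j},v_{\underline j})$. Hence $$a_3(n)=\prod_{p\in\Pi_1}\bigl(\nu_p(3n+1)+1\bigr).$$ (4) For $\lambda\in\mathcal E_n$ write $z_\lambda=\tfrac12(u+v\sqrt{-3})$ with $(u,v)=\vartheta(c_\lambda)$. Then $z_\lambda\in\mathcal R$; the map $\lambda\mapsto z_\lambda$ is a bijection from $\mathcal E_n$ onto the set of elements of $\mathcal R$ of norm $3n+1$ of the form $\tfrac12(u+v\sqrt{-3})$ with integers $u\equiv v\equiv1\pmod 3$; and the map $\lambda\mapsto z_\lambda\mathcal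 R$ is a bijection from $\mathcal E_n$ onto the set of ideals of $\mathcal R$ of norm $3n+1$. -/

import Mathlib

open scoped ComplexConjugate

namespace ThreeCore

/-! Partitions are represented by their Young diagrams (`YoungDiagram.equivListRowLens`);
a box is a pair (row, column). -/

/-- The hook of a box `b`: the box itself, the boxes to its right in the same row and the boxes
below it in the same column. -/
def hook (μ : YoungDiagram) (b : ℕ × ℕ) : Finset (ℕ × ℕ) :=
  μ.cells.filter fun d => (d.1 = b.1 ∧ b.2 ≤ d.2) ∨ (d.2 = b.2 ∧ b.1 ≤ d.1)

/-- No hook has length three. -/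
def IsThreeCore (μ : YoungDiagram) : Prop :=
  ∀ b ∈ μ.cells, (hook μ b).card ≠ 3

/-- `𝓔_n`, the set of 3-core partitions of `n`. -/
def threeCores (n : ℕ) : Set YoungDiagram :=
  {μ | IsThreeCore μ ∧ μ.card = n}

/-- `a₃(n)`, the number of 3-core partitions of `n`. -/
noncomputable def a3 (n : ℕ) : ℕ := (threeCores n).ncard

/-- The diagonal boxes of the diagram. -/
def diagonal (μ : YoungDiagram) : Finset (ℕ × ℕ) :=
  μ.cells.filter fun d => d.1 = d.2

/-- The arms in the Frobenius symbol: for each diagonal box, the number of boxes to its right. -/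
def arms (μ : YoungDiagram) : Finset ℕ :=
  (diagonal μ).image fun d => μ.rowLen d.1 - (d.2 + 1)

/-- The legs in the Frobenius symbol: for each diagonal box, the number of boxes below it. -/
def legs (μ : YoungDiagram) : Finset ℕ :=
  (diagonal μ).image fun d => μ.colLen d.2 - (d.1 + 1)

/-- The black beads over the fence on runner `i` of the pointed 3-abacus: a bead at position `q`
corresponds to the arm `3 q + i`. -/
def blackBeads (μ : YoungDiagram) (i : Fin 3) : Finset ℕ :=
  (arms μ).filter fun a => a % 3 = (i : ℕ)

/-- The white beads under the fence on runner `i` of the pointed 3-abacus: a bead at position `q`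
corresponds to the leg `3 q + (2 - i)`. -/
def whiteBeads (μ : YoungDiagram) (i : Fin 3) : Finset ℕ :=
  (legs μ).filter fun l => l % 3 = 2 - (i : ℕ)

/-- The characteristic vector `(c₀, c₁, c₂)` of a 3-core partition. -/
def charVec (μ : YoungDiagram) : Fin 3 → ℤ := fun i =>
  if whiteBeads μ i = ∅ then ((blackBeads μ i).card : ℤ) else -((whiteBeads μ i).card : ℤ)

/-- The identification of `ℤ²` with the set of integral triples of sum zero. -/
def toTriple (c : ℤ × ℤ) : Fin 3 → ℤ := ![-c.1 - c.2, c.1, c.2]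

/-- `𝓒_n`: the characteristic vectors of the 3-core partitions of `n`, as elements of `ℤ²`. -/
def charVecs (n : ℕ) : Set (ℤ × ℤ) :=
  {c | ∃ μ ∈ threeCores n, charVec μ = toTriple c}

/-- `𝓤_k`: the integral solutions of `x² + 3 y² = k`. -/
def solutions (k : ℕ) : Set (ℤ × ℤ) :=
  {w | w.1 ^ 2 + 3 * w.2 ^ 2 = (k : ℤ)}

/-- The map `ϑ`. -/
def theta (c : ℤ × ℤ) : ℤ × ℤ := (6 * c.1 + 3 * c.2 + 1, 3 * c.2 + 1)

/-- `𝐣 = exp (2 i π / 3)`. -/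
noncomputable def jRoot : ℂ := Complex.exp (2 * Real.pi * Complex.I / 3)

/-- The ring `ℤ[𝐣]` of Eisenstein integers, as a subring of `ℂ`. -/
noncomputable abbrev Eis : Subalgebra ℤ ℂ := Algebra.adjoin ℤ {jRoot}

theorem conj_jRoot : conj jRoot = jRoot ^ 2 := by
  unfold jRoot
  rw [← Complex.exp_conj, ← Complex.exp_nat_mul, Complex.exp_eq_exp_iff_exists_int]
  refine ⟨-1, ?_⟩
  have h2 : conj (2 : ℂ) = 2 := map_ofNat _ 2
  have h3 : conj (3 : ℂ) = 3 := map_ofNat _ 3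
  simp only [map_div₀, map_mul, h2, h3, Complex.conj_ofReal, Complex.conj_I]
  push_cast
  ring

theorem conj_mem_Eis {z : ℂ} (hz : z ∈ Eis) : conj z ∈ Eis := by
  induction hz using Algebra.adjoin_induction with
  | mem x hx =>
    rw [Set.mem_singleton_iff.1 hx, conj_jRoot]
    exact pow_mem (Algebra.subset_adjoin (Set.mem_singleton _)) 2
  | algebraMap r => simp
  | add x y _ _ hx hy => rw [map_add]; exact add_mem hx hy
  | mul x y _ _ hx hy => rw [map_mul]; exact mul_mem hx hy

/-- Complex conjugation on `ℤ[𝐣]`. -/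
noncomputable def eisConj (z : Eis) : Eis := ⟨conj (z : ℂ), conj_mem_Eis z.2⟩

/-- The norm `z ↦ z * conj z` of `ℤ[𝐣]` (its value is a rational integer). -/
noncomputable def eisNorm (z : Eis) : Eis := z * eisConj z

/-- The complex number `(u + v √(-3)) / 2`. -/
noncomputable def rho (w : ℤ × ℤ) : ℂ :=
  ((w.1 : ℂ) + (w.2 : ℂ) * (Complex.I * (Real.sqrt 3 : ℂ))) / 2

/-- The prime numbers congruent to `r` modulo `3`. -/
abbrev PrimesMod (r : ℕ) : Type := {p : ℕ // p.Prime ∧ p % 3 = r}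

/-- `𝓥_n`: the families `(j_p)`, `p ≡ 1 (mod 3)` prime, with `0 ≤ j_p ≤ ν_p(3n+1)`. -/
def exponents (n : ℕ) : Set (PrimesMod 1 → ℕ) :=
  {j | ∀ p, j p ≤ padicValNat p (3 * n + 1)}

/-- `q_n`, the product of `p ^ (ν_p(3n+1) / 2)` over the primes `p ≡ 2 (mod 3)`
(all but finitely many factors are `1`). -/
noncomputable def qElem (n : ℕ) : ℕ :=
  ∏ᶠ p : PrimesMod 2, (p : ℕ) ^ (padicValNat p (3 * n + 1) / 2)

/-- `x_j`, the product of `x_p ^ j_p * conj x_p ^ (ν_p(3n+1) - j_p)` over the primes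
`p ≡ 1 (mod 3)` (all but finitely many factors are `1` when `j ∈ 𝓥_n`). -/
noncomputable def xElem (x : PrimesMod 1 → Eis) (n : ℕ) (j : PrimesMod 1 → ℕ) : Eis :=
  ∏ᶠ p : PrimesMod 1, x p ^ j p * eisConj (x p) ^ (padicValNat p (3 * n + 1) - j p)

/-- `y_j = q_n x_j`. -/
noncomputable def yElem (x : PrimesMod 1 → Eis) (n : ℕ) (j : PrimesMod 1 → ℕ) : Eis :=
  (qElem n : Eis) * xElem x n j

end ThreeCore

open ThreeCore

/-!
A Young diagram is encoded by its bead set `{λᵢ - i - 1 : i ≥ 0} ⊂ ℤ`, whose complement is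
`{j - λ'ⱼ : j ≥ 0}` (`notMem_beads_iff`). The hook lengths are the differences between a bead and a
smaller gap, so that a diagram is a 3-core if and only if its bead set is stable under `t ↦ t - 3`
(`isThreeCore_iff`): the beads fill a ray `q < cᵢ` on each runner `{3 q + i}`, and `(c₀, c₁, c₂)` is
the characteristic vector (`beads_eq_flushBeads`). The arms are the nonnegative beads and the legs
correspond to the negative gaps. As there are as many arms as legs, the `cᵢ` sum to zero; cutting
the diagram into the hooks of its diagonal boxes expresses its size as a quadratic polynomial in
the `cᵢ` (`two_mul_card`). Conversely, each integral vector of sum zero comes from a 3-core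
(`exists_beads_eq_flushBeads`). Thus `charVec` identifies the 3-cores of size `n` with the solutions
of `3 (x² + x y + y²) + x + 2 y = n` (`exists_equiv_latticePoints`).

Completing the square, `(x, y) ↦ (3 x + 3 y + 1) + (3 y + 1) 𝐣`, which is `rho ∘ theta`, maps these
solutions bijectively onto the elements of `ℤ[𝐣]` of norm `3 n + 1` congruent to `1 + 𝐣` modulo `3`
(`exists_equiv_primaryOfNorm`). The six units of `ℤ[𝐣]` represent the six invertible classes modulo
`3`, hence each element of norm prime to `3` has exactly one associate of this form; since `ℤ[𝐣]` is
principal, these elements are also the ideals of norm `3 n + 1` (`exists_equiv_ideals`).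

It remains to describe the elements of norm `3 n + 1` up to units. The primes `p ≡ 2 (mod 3)` are
inert, which forces the evenness condition; the primes `p ≡ 1 (mod 3)` split into two primes `x_p`
and `conj x_p` that are not associated. An element of norm `3 n + 1` is determined up to a unit by
its valuations at the `x_p` (`dvd_of_emultiplicity_eq`), and `y_j` has norm `3 n + 1` and valuation
`j_p` at `x_p` (`norm_yElem`, `emultiplicity_yElem`).
-/

namespace ThreeCore

/-! ### The bead set of a Young diagram -/

/-- The `i`-th bead of a diagram, counted from the right: the end of its `i`-th row in the
coordinate `column - row - 1`. -/
def bead (μ : YoungDiagram) (i : ℕ) : ℤ := (μ.rowLen i : ℤ) - i - 1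

/-- The bead set (Maya diagram) of a Young diagram: the set of the integers `λᵢ - i - 1`, including
the rows of length zero. The fence of the abacus lies between `-1` and `0`. -/
def beads (μ : YoungDiagram) : Set ℤ := Set.range (bead μ)

theorem bead_strictAnti (μ : YoungDiagram) : StrictAnti (bead μ) := by
  intro i j hij
  have := μ.rowLen_anti i j hij.le
  unfold bead
  omega

theorem lt_rowLen_iff_lt_colLen (μ : YoungDiagram) (i j : ℕ) :
    j < μ.rowLen i ↔ i < μ.colLen j := by
  rw [← YoungDiagram.mem_iff_lt_rowLen, YoungDiagram.mem_iff_lt_colLen]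

/-- The gaps of the bead set are the ends of the columns. -/
theorem notMem_beads_iff (μ : YoungDiagram) (t : ℤ) :
    t ∉ beads μ ↔ ∃ j : ℕ, (j : ℤ) - μ.colLen j = t := by
  constructor
  · intro ht
    -- the row `i` of the largest bead below `t` determines the column `t + i` that ends at `t`
    have hex : ∃ i : ℕ, bead μ i ≤ t := by
      refine ⟨((μ.rowLen 0 : ℤ) - t).toNat, ?_⟩
      have := μ.rowLen_anti 0 ((μ.rowLen 0 : ℤ) - t).toNat (Nat.zero_le _)
      unfold bead
      omega
    classical
    obtain ⟨i, hi, hmin⟩ : ∃ i, bead μ i ≤ t ∧ ∀ k < i, ¬ bead μ k ≤ t :=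
      ⟨Nat.find hex, Nat.find_spec hex, fun k hk => Nat.find_min hex hk⟩
    have hne : bead μ i ≠ t := fun h => ht ⟨i, h⟩
    unfold bead at hi hne
    obtain ⟨j, hj⟩ : ∃ j : ℕ, (j : ℤ) = t + i := ⟨(t + i).toNat, by omega⟩
    have h1 : ¬ i < μ.colLen j := by
      rw [← lt_rowLen_iff_lt_colLen]
      omega
    refine ⟨j, ?_⟩
    rcases Nat.eq_zero_or_pos i with rfl | hpos
    · omega
    · have h2 := hmin (i - 1) (by omega)
      have h3 : i - 1 < μ.colLen j := by
        rw [← lt_rowLen_iff_lt_colLen]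
        unfold bead at h2
        omega
      omega
  · rintro ⟨j, hj⟩ ⟨i, hi⟩
    have := lt_rowLen_iff_lt_colLen μ i j
    unfold bead at hi
    omega

theorem beads_injective : Function.Injective beads := by
  intro μ ν h
  have h1 : StrictMono fun i => -bead μ i := fun i j hij => neg_lt_neg (bead_strictAnti μ hij)
  have h2 : StrictMono fun i => -bead ν i := fun i j hij => neg_lt_neg (bead_strictAnti ν hij)
  have h3 : Set.range (fun i => -bead μ i) = Set.range (fun i => -bead ν i) := by
    have := congrArg (fun s => Neg.neg '' s) h
    simpa only [beads, ← Set.range_comp, Function.comp_def] using this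
  have h4 := (h1.range_inj h2).1 h3
  have h5 : ∀ i, μ.rowLen i = ν.rowLen i := by
    intro i
    have := congrFun h4 i
    simp only [bead] at this
    omega
  refine YoungDiagram.ext (Finset.ext ?_)
  rintro ⟨i, j⟩
  rw [YoungDiagram.mem_cells, YoungDiagram.mem_cells, YoungDiagram.mem_iff_lt_rowLen,
    YoungDiagram.mem_iff_lt_rowLen, h5]

/-! ### Hooks, arms and legs -/

theorem card_hook {μ : YoungDiagram} {i j : ℕ} (h : (i, j) ∈ μ) :
    (hook μ (i, j)).card + i + j + 1 = μ.rowLen i + μ.colLen j := by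
  have hr := YoungDiagram.mem_iff_lt_rowLen.1 h
  have hc := YoungDiagram.mem_iff_lt_colLen.1 h
  have hh : hook μ (i, j) = (Finset.Ico j (μ.rowLen i)).image (fun k => (i, k)) ∪
      (Finset.Ico (i + 1) (μ.colLen j)).image (fun k => (k, j)) := by
    ext ⟨a, b⟩
    simp only [hook, Finset.mem_filter, YoungDiagram.mem_cells, Finset.mem_union,
      Finset.mem_image, Finset.mem_Ico, Prod.mk.injEq]
    constructor
    · rintro ⟨hm, ⟨rfl, hb⟩ | ⟨rfl, ha⟩⟩
      · exact Or.inl ⟨b, ⟨hb, YoungDiagram.mem_iff_lt_rowLen.1 hm⟩, rfl, rfl⟩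
      · rcases ha.eq_or_lt with rfl | ha
        · exact Or.inl ⟨b, ⟨le_rfl, hr⟩, rfl, rfl⟩
        · exact Or.inr ⟨a, ⟨ha, YoungDiagram.mem_iff_lt_colLen.1 hm⟩, rfl, rfl⟩
    · rintro (⟨k, ⟨h1, h2⟩, rfl, rfl⟩ | ⟨k, ⟨h1, h2⟩, rfl, rfl⟩)
      · exact ⟨YoungDiagram.mem_iff_lt_rowLen.2 h2, Or.inl ⟨rfl, h1⟩⟩
      · exact ⟨YoungDiagram.mem_iff_lt_colLen.2 h2, Or.inr ⟨rfl, by omega⟩⟩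
  rw [hh, Finset.card_union_of_disjoint, Finset.card_image_of_injective,
    Finset.card_image_of_injective, Nat.card_Ico, Nat.card_Ico]
  · omega
  · exact fun a b h => (Prod.mk.inj h).1
  · exact fun a b h => (Prod.mk.inj h).2
  · rw [Finset.disjoint_left]
    simp only [Finset.mem_image, Finset.mem_Ico]
    rintro _ ⟨k, _, rfl⟩ ⟨l, hl, h⟩
    have := (Prod.mk.inj h).1
    omega

/-- The hook lengths are the differences between a bead and a gap to its left. -/
theorem isThreeCore_iff (μ : YoungDiagram) :
    IsThreeCore μ ↔ ∀ t ∈ beads μ, t - 3 ∈ beads μ := by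
  constructor
  · rintro h _ ⟨i, rfl⟩
    by_contra hn
    obtain ⟨j, hj⟩ := (notMem_beads_iff μ _).1 hn
    have h0 := lt_rowLen_iff_lt_colLen μ i j
    unfold bead at hj
    have hm : (i, j) ∈ μ := YoungDiagram.mem_iff_lt_rowLen.2 (by omega)
    have := card_hook hm
    exact h (i, j) hm (by omega)
  · rintro h ⟨i, j⟩ hm h3
    have h1 := card_hook ((YoungDiagram.mem_cells _).1 hm)
    refine (notMem_beads_iff μ (bead μ i - 3)).2 ⟨j, ?_⟩ (h _ ⟨i, rfl⟩)
    unfold bead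
    omega

theorem mem_diagonal {μ : YoungDiagram} {i j : ℕ} :
    (i, j) ∈ diagonal μ ↔ (i, j) ∈ μ ∧ i = j := by
  simp [diagonal]

theorem mem_arms_iff (μ : YoungDiagram) (a : ℕ) : a ∈ arms μ ↔ (a : ℤ) ∈ beads μ := by
  simp only [arms, Finset.mem_image, Prod.exists, mem_diagonal, beads, Set.mem_range]
  constructor
  · rintro ⟨i, j, ⟨hm, rfl⟩, rfl⟩
    have := YoungDiagram.mem_iff_lt_rowLen.1 hm
    exact ⟨i, by unfold bead; omega⟩
  · rintro ⟨i, hi⟩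
    unfold bead at hi
    exact ⟨i, i, ⟨YoungDiagram.mem_iff_lt_rowLen.2 (by omega), rfl⟩, by omega⟩

theorem mem_legs_iff (μ : YoungDiagram) (l : ℕ) : l ∈ legs μ ↔ -1 - (l : ℤ) ∉ beads μ := by
  simp only [legs, Finset.mem_image, Prod.exists, mem_diagonal, notMem_beads_iff]
  constructor
  · rintro ⟨i, j, ⟨hm, rfl⟩, rfl⟩
    have := YoungDiagram.mem_iff_lt_colLen.1 hm
    exact ⟨i, by omega⟩
  · rintro ⟨i, hi⟩
    exact ⟨i, i, ⟨YoungDiagram.mem_iff_lt_colLen.2 (by omega), rfl⟩, by omega⟩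

theorem arm_injOn (μ : YoungDiagram) :
    Set.InjOn (fun d : ℕ × ℕ => μ.rowLen d.1 - (d.2 + 1)) (diagonal μ) := by
  rintro ⟨i, i'⟩ hi ⟨j, j'⟩ hj h
  obtain ⟨hi, rfl⟩ := mem_diagonal.1 hi
  obtain ⟨hj, rfl⟩ := mem_diagonal.1 hj
  have h1 := YoungDiagram.mem_iff_lt_rowLen.1 hi
  have h2 := YoungDiagram.mem_iff_lt_rowLen.1 hj
  have : i = j := (bead_strictAnti μ).injective (by simp only [bead] at h ⊢; omega)
  rw [this]

theorem leg_injOn (μ : YoungDiagram) :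
    Set.InjOn (fun d : ℕ × ℕ => μ.colLen d.2 - (d.1 + 1)) (diagonal μ) := by
  rintro ⟨i, i'⟩ hi ⟨j, j'⟩ hj h
  obtain ⟨hi, rfl⟩ := mem_diagonal.1 hi
  obtain ⟨hj, rfl⟩ := mem_diagonal.1 hj
  have h1 := YoungDiagram.mem_iff_lt_colLen.1 hi
  have h2 := YoungDiagram.mem_iff_lt_colLen.1 hj
  simp only at h
  rcases lt_trichotomy i j with hij | rfl | hij
  · have := μ.colLen_anti _ _ hij.le
    omega
  · rfl
  · have := μ.colLen_anti _ _ hij.le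
    omega

theorem card_arms_eq_card_legs (μ : YoungDiagram) : (arms μ).card = (legs μ).card := by
  rw [arms, legs, Finset.card_image_of_injOn (arm_injOn μ), Finset.card_image_of_injOn (leg_injOn μ)]

/-- The hooks of the diagonal boxes partition the diagram. -/
theorem card_eq_sum_arms_add_legs (μ : YoungDiagram) :
    μ.card = ∑ a ∈ arms μ, a + ∑ l ∈ legs μ, (l + 1) := by
  rw [arms, legs, Finset.sum_image (arm_injOn μ), Finset.sum_image (leg_injOn μ),
    ← Finset.sum_add_distrib]
  have hmap : ∀ d ∈ μ.cells, (min d.1 d.2, min d.1 d.2) ∈ diagonal μ := by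
    rintro ⟨i, j⟩ hd
    exact mem_diagonal.2 ⟨μ.up_left_mem (min_le_left _ _) (min_le_right _ _)
      ((YoungDiagram.mem_cells _).1 hd), rfl⟩
  rw [YoungDiagram.card, Finset.card_eq_sum_card_fiberwise hmap]
  refine Finset.sum_congr rfl ?_
  rintro ⟨i, j⟩ hd
  obtain ⟨hm, rfl⟩ := mem_diagonal.1 hd
  have hfib : μ.cells.filter (fun d => (min d.1 d.2, min d.1 d.2) = (i, i)) = hook μ (i, i) := by
    refine Finset.filter_congr ?_
    rintro ⟨a, b⟩ _
    simp only [Prod.mk.injEq, and_self]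
    omega
  rw [hfib]
  have h1 := YoungDiagram.mem_iff_lt_rowLen.1 hm
  have h2 := YoungDiagram.mem_iff_lt_colLen.1 hm
  have := card_hook hm
  simp only
  omega

/-! ### Characteristic vectors -/

/-- The bead set with `{q : 3 q + i is a bead} = {q : q < c i}` on each runner `i`. -/
def flushBeads (c : Fin 3 → ℤ) : Set ℤ :=
  {t | ∃ (i : Fin 3) (q : ℤ), t = 3 * q + (i : ℕ) ∧ q < c i}

theorem mem_flushBeads {c : Fin 3 → ℤ} {i : Fin 3} {q : ℤ} :
    3 * q + ((i : ℕ) : ℤ) ∈ flushBeads c ↔ q < c i := by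
  constructor
  · rintro ⟨k, r, h, hr⟩
    obtain rfl : i = k := Fin.ext (by omega)
    obtain rfl : q = r := by omega
    exact hr
  · exact fun h => ⟨i, q, rfl, h⟩

theorem exists_runner (t : ℤ) : ∃ (i : Fin 3) (q : ℤ), t = 3 * q + ((i : ℕ) : ℤ) :=
  ⟨⟨(t % 3).toNat, by omega⟩, t / 3, by simp only; omega⟩

theorem blackBeads_eq {μ : YoungDiagram} {c : Fin 3 → ℤ} (h : beads μ = flushBeads c) (i : Fin 3) :
    blackBeads μ i = (Finset.range (c i).toNat).image fun q => 3 * q + (i : ℕ) := by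
  ext a
  simp only [blackBeads, Finset.mem_filter, mem_arms_iff, h, Finset.mem_image, Finset.mem_range]
  constructor
  · rintro ⟨h1, h2⟩
    have h3 : (a : ℤ) = 3 * ((a / 3 : ℕ) : ℤ) + ((i : ℕ) : ℤ) := by omega
    rw [h3, mem_flushBeads] at h1
    exact ⟨a / 3, by omega, by omega⟩
  · rintro ⟨q, hq, rfl⟩
    refine ⟨?_, by omega⟩
    push_cast
    rw [mem_flushBeads]
    omega

/-- The legs on runner `i` are the `l` for which the gap `-1 - l` lies on that runner. -/
theorem whiteBeads_eq {μ : YoungDiagram} {c : Fin 3 → ℤ} (h : beads μ = flushBeads c) (i : Fin 3) :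
    whiteBeads μ i = (Finset.range (-c i).toNat).image fun q => 3 * q + (2 - (i : ℕ)) := by
  ext a
  simp only [whiteBeads, Finset.mem_filter, mem_legs_iff, h, Finset.mem_image, Finset.mem_range]
  constructor
  · rintro ⟨h1, h2⟩
    have h3 : -1 - (a : ℤ) = 3 * (-1 - ((a / 3 : ℕ) : ℤ)) + ((i : ℕ) : ℤ) := by omega
    rw [h3, mem_flushBeads] at h1
    exact ⟨a / 3, by omega, by omega⟩
  · rintro ⟨q, hq, rfl⟩
    refine ⟨?_, by omega⟩
    have h3 : -1 - ((3 * q + (2 - (i : ℕ)) : ℕ) : ℤ) = 3 * (-1 - (q : ℤ)) + ((i : ℕ) : ℤ) := by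
      omega
    rw [h3, mem_flushBeads]
    omega

theorem card_blackBeads {μ : YoungDiagram} {c : Fin 3 → ℤ} (h : beads μ = flushBeads c)
    (i : Fin 3) : (blackBeads μ i).card = (c i).toNat := by
  rw [blackBeads_eq h, Finset.card_image_of_injective _ fun a b h => by omega,
    Finset.card_range]

theorem card_whiteBeads {μ : YoungDiagram} {c : Fin 3 → ℤ} (h : beads μ = flushBeads c)
    (i : Fin 3) : (whiteBeads μ i).card = (-c i).toNat := by
  rw [whiteBeads_eq h, Finset.card_image_of_injective _ fun a b h => by omega,
    Finset.card_range]

theorem charVec_eq {μ : YoungDiagram} {c : Fin 3 → ℤ} (h : beads μ = flushBeads c) :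
    charVec μ = c := by
  funext i
  have h1 := card_blackBeads h i
  have h2 := card_whiteBeads h i
  unfold charVec
  split_ifs with h3
  · rw [h3, Finset.card_empty] at h2
    omega
  · have := Finset.card_pos.2 (Finset.nonempty_iff_ne_empty.2 h3)
    omega

theorem isThreeCore_of_beads_eq {μ : YoungDiagram} {c : Fin 3 → ℤ} (h : beads μ = flushBeads c) :
    IsThreeCore μ := by
  rw [isThreeCore_iff, h]
  rintro _ ⟨i, q, rfl, hq⟩
  exact ⟨i, q - 1, by ring, by omega⟩

/-- On each runner of a 3-core the beads form a ray, neither empty nor the whole runner. -/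
theorem beads_eq_flushBeads {μ : YoungDiagram} (h : IsThreeCore μ) :
    beads μ = flushBeads (charVec μ) := by
  rw [isThreeCore_iff] at h
  have hruns : ∀ i : Fin 3, ∃ c : ℤ, ∀ q : ℤ, 3 * q + ((i : ℕ) : ℤ) ∈ beads μ ↔ q < c := by
    intro i
    have hdown : ∀ (k : ℕ) (q : ℤ), 3 * q + ((i : ℕ) : ℤ) ∈ beads μ →
        3 * (q - k) + ((i : ℕ) : ℤ) ∈ beads μ := by
      intro k q hq
      induction k with
      | zero => simpa using hq
      | succ k ih =>
        have := h _ ih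
        convert this using 1
        push_cast
        ring
    obtain ⟨m, hm, hmax⟩ : ∃ m : ℤ, 3 * m + ((i : ℕ) : ℤ) ∈ beads μ ∧
        ∀ q, 3 * q + ((i : ℕ) : ℤ) ∈ beads μ → q ≤ m := by
      refine Int.exists_greatest_of_bdd ⟨μ.rowLen 0, ?_⟩ ?_
      · rintro q ⟨k, hk⟩
        have := μ.rowLen_anti 0 k (Nat.zero_le _)
        unfold bead at hk
        omega
      · -- the rows below the diagram give beads on every runner
        refine ⟨-1 - (μ.colLen 0 : ℤ), 3 * μ.colLen 0 + 2 - (i : ℕ), ?_⟩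
        have h0 := lt_rowLen_iff_lt_colLen μ (3 * μ.colLen 0 + 2 - (i : ℕ)) 0
        unfold bead
        omega
    refine ⟨m + 1, fun q => ⟨fun hq => by have := hmax q hq; omega, fun hq => ?_⟩⟩
    have := hdown (m - q).toNat m hm
    rwa [Int.toNat_of_nonneg (by omega), sub_sub_cancel] at this
  choose c hc using hruns
  have key : beads μ = flushBeads c := by
    ext t
    obtain ⟨i, q, rfl⟩ := exists_runner t
    rw [hc, mem_flushBeads]
  rw [charVec_eq key, key]

theorem charVec_injOn : Set.InjOn charVec {μ | IsThreeCore μ} := by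
  intro μ hμ ν hν h
  apply beads_injective
  rw [beads_eq_flushBeads hμ, beads_eq_flushBeads hν, h]

theorem sum_eq_sum_filter_mod (s : Finset ℕ) (f : ℕ → ℤ) :
    ∑ a ∈ s, f a = ∑ i : Fin 3, ∑ a ∈ s.filter (fun a => a % 3 = (i : ℕ)), f a := by
  rw [← Finset.sum_fiberwise_of_maps_to (s := s) (t := (Finset.univ : Finset (Fin 3)))
    (g := fun a => (⟨a % 3, Nat.mod_lt _ (by norm_num)⟩ : Fin 3)) (fun _ _ => Finset.mem_univ _)]
  refine Finset.sum_congr rfl fun i _ => Finset.sum_congr ?_ fun _ _ => rfl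
  refine Finset.filter_congr fun a _ => ?_
  rw [Fin.ext_iff]

theorem sum_arms (μ : YoungDiagram) (f : ℕ → ℤ) :
    ∑ a ∈ arms μ, f a = ∑ i : Fin 3, ∑ a ∈ blackBeads μ i, f a :=
  sum_eq_sum_filter_mod _ f

theorem sum_legs (μ : YoungDiagram) (f : ℕ → ℤ) :
    ∑ l ∈ legs μ, f l = ∑ i : Fin 3, ∑ l ∈ whiteBeads μ i, f l := by
  rw [sum_eq_sum_filter_mod, ← Equiv.sum_comp Fin.revPerm]
  refine Finset.sum_congr rfl fun i _ => Finset.sum_congr ?_ fun _ _ => rfl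
  refine Finset.filter_congr fun l _ => ?_
  rw [Fin.revPerm_apply, Fin.val_rev]
  omega

theorem sum_charVec {μ : YoungDiagram} {c : Fin 3 → ℤ} (h : beads μ = flushBeads c) :
    ∑ i, c i = 0 := by
  have h1 : ((arms μ).card : ℤ) = ∑ i, ((c i).toNat : ℤ) := by
    have := sum_arms μ fun _ => 1
    simpa [card_blackBeads h] using this
  have h2 : ((legs μ).card : ℤ) = ∑ i, ((-c i).toNat : ℤ) := by
    have := sum_legs μ fun _ => 1
    simpa [card_whiteBeads h] using this
  rw [card_arms_eq_card_legs, h2, ← sub_eq_zero, ← Finset.sum_sub_distrib] at h1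
  rw [← neg_eq_zero, ← h1, ← Finset.sum_neg_distrib]
  exact Finset.sum_congr rfl fun i _ => by omega

theorem two_mul_sum_range (m : ℕ) (b : ℤ) :
    2 * ∑ q ∈ Finset.range m, (3 * (q : ℤ) + b) = 3 * m * (m - 1) + 2 * b * m := by
  induction m with
  | zero => simp
  | succ m ih =>
    rw [Finset.sum_range_succ, mul_add, ih]
    push_cast
    ring

/-- The size of a 3-core as a quadratic function of its characteristic vector. -/
theorem two_mul_card {μ : YoungDiagram} {c : Fin 3 → ℤ} (h : beads μ = flushBeads c) :
    2 * (μ.card : ℤ) = ∑ i, (3 * c i * (c i - 1) + 2 * ((i : ℕ) : ℤ) * c i) := by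
  rw [card_eq_sum_arms_add_legs]
  push_cast
  rw [sum_arms μ fun a => (a : ℤ), sum_legs μ fun a => (a : ℤ) + 1, ← Finset.sum_add_distrib,
    Finset.mul_sum]
  refine Finset.sum_congr rfl fun i _ => ?_
  rw [blackBeads_eq h, whiteBeads_eq h,
    Finset.sum_image fun a _ b _ h => by omega,
    Finset.sum_image fun a _ b _ h => by omega, mul_add]
  have h2 : ∀ q : ℕ, ((3 * q + (2 - (i : ℕ)) : ℕ) : ℤ) + 1 = 3 * (q : ℤ) + (3 - (i : ℕ)) := by
    intro q
    omega
  simp only [h2]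
  push_cast
  rw [two_mul_sum_range, two_mul_sum_range]
  rcases le_total 0 (c i) with hc | hc
  · obtain ⟨m, hm⟩ := Int.eq_ofNat_of_zero_le hc
    rw [hm]
    simp
  · obtain ⟨m, hm⟩ := Int.exists_eq_neg_ofNat hc
    rw [hm]
    simp
    ring

/-! ### Existence of a 3-core with a given characteristic vector -/

theorem exists_rowLen_eq {f : ℕ → ℕ} (hf : Antitone f) {N : ℕ} (hN : f N = 0) :
    ∃ μ : YoungDiagram, ∀ i, μ.rowLen i = f i := by
  have hlt : ∀ i j, j < f i → i < N := by
    intro i j h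
    by_contra hi
    have := hf (not_lt.1 hi)
    omega
  let μ : YoungDiagram :=
    { cells := (Finset.range N ×ˢ Finset.range (f 0)).filter fun d => d.2 < f d.1
      isLowerSet := by
        rintro ⟨a, b⟩ ⟨i, j⟩ ⟨h1, h2⟩ hm
        simp only [Finset.coe_filter, Finset.mem_product, Finset.mem_range,
          Set.mem_ofPred_eq] at hm h1 h2 ⊢
        have := hf h1
        omega }
  have hμ : ∀ i j, (i, j) ∈ μ ↔ j < f i := by
    intro i j
    rw [← YoungDiagram.mem_cells]
    simp only [μ, Finset.mem_filter, Finset.mem_product, Finset.mem_range]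
    have h1 := hlt i j
    have h2 := hf (Nat.zero_le i)
    omega
  refine ⟨μ, fun i => ?_⟩
  have key : ∀ j, j < μ.rowLen i ↔ j < f i := fun j => by
    rw [← YoungDiagram.mem_iff_lt_rowLen, hμ]
  have h1 := key (μ.rowLen i)
  have h2 := key (f i)
  omega

/-- A set of `N` integers in `[-N, ∞)`, completed by `(-∞, -N)`, is the bead set of a diagram. -/
theorem exists_beads_eq {F : Finset ℤ} {N : ℕ} (hF : F.card = N) (hge : ∀ t ∈ F, -(N : ℤ) ≤ t) :
    ∃ μ : YoungDiagram, ∀ t, t ∈ beads μ ↔ t ∈ F ∨ t < -(N : ℤ) := by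
  -- the elements of `F` in decreasing order, followed by `-N - 1, -N - 2, …`
  let b : ℕ → ℤ := fun i =>
    if h : i < N then F.orderEmbOfFin hF (Fin.rev ⟨i, h⟩) else -(i : ℤ) - 1
  have hb1 : ∀ i (h : i < N), b i = F.orderEmbOfFin hF (Fin.rev ⟨i, h⟩) := fun i h => dif_pos h
  have hb2 : ∀ i, N ≤ i → b i = -(i : ℤ) - 1 := fun i h => dif_neg (by omega)
  have hmem : ∀ i, i < N → b i ∈ F := fun i h => by
    rw [hb1 i h]
    exact Finset.orderEmbOfFin_mem _ _ _
  -- strict decrease of `b` makes the row lengths `b i + i + 1` weakly decreasing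
  have hanti : ∀ i, b (i + 1) < b i := by
    intro i
    rcases lt_trichotomy (i + 1) N with h | h | h
    · rw [hb1 _ h, hb1 i (by omega)]
      exact (F.orderEmbOfFin hF).strictMono (Fin.rev_lt_rev.2 (Nat.lt_succ_self i))
    · have := hge _ (hmem i (by omega))
      rw [hb2 _ h.ge]
      omega
    · rw [hb2 _ h.le, hb2 i (by omega)]
      push_cast
      omega
  have hmono : Antitone fun i => b i + i + 1 :=
    antitone_nat_of_succ_le fun i => by have := hanti i; push_cast; omega
  have hnonneg : ∀ i, 0 ≤ b i + i + 1 := fun i => by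
    have := hmono (le_max_left i N)
    have h2 := hb2 _ (le_max_right i N)
    simp only [h2] at this
    omega
  obtain ⟨μ, hμ⟩ := exists_rowLen_eq (f := fun i => (b i + i + 1).toNat)
    (fun i j h => Int.toNat_le_toNat (hmono h)) (N := N) (by simp only [hb2 N le_rfl]; omega)
  have hbead : ∀ i, bead μ i = b i := fun i => by
    have := hnonneg i
    rw [bead, hμ]
    omega
  refine ⟨μ, fun t => ?_⟩
  simp only [beads, Set.mem_range, hbead]
  constructor
  · rintro ⟨i, rfl⟩
    rcases lt_or_ge i N with h | h
    · exact Or.inl (hmem i h)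
    · right
      rw [hb2 i h]
      omega
  · rintro (h | h)
    · have hr : t ∈ Set.range (F.orderEmbOfFin hF) := by
        rw [Finset.range_orderEmbOfFin]
        exact h
      obtain ⟨k, rfl⟩ := hr
      exact ⟨(Fin.rev k : ℕ), by rw [hb1 _ (Fin.rev k).2, Fin.eta, Fin.rev_rev]⟩
    · exact ⟨(-t - 1).toNat, by rw [hb2 _ (by omega)]; omega⟩

theorem exists_beads_eq_flushBeads {c : Fin 3 → ℤ} (hc : ∑ i, c i = 0) :
    ∃ μ : YoungDiagram, beads μ = flushBeads c := by
  obtain ⟨M, hM⟩ : ∃ M : ℕ, ∀ i, -(M : ℤ) ≤ c i :=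
    ⟨∑ i, (c i).natAbs, fun i => by
      have := Finset.single_le_sum (f := fun i => (c i).natAbs) (fun _ _ => Nat.zero_le _)
        (Finset.mem_univ i)
      omega⟩
  -- all beads on the positions `q ≥ -M` of the three runners
  let F : Finset ℤ := Finset.univ.biUnion fun i : Fin 3 =>
    (Finset.Ico (-(M : ℤ)) (c i)).image fun q => 3 * q + ((i : ℕ) : ℤ)
  have hF : ∀ t, t ∈ F ↔ ∃ (i : Fin 3) (q : ℤ), t = 3 * q + (i : ℕ) ∧ q < c i ∧ -(M : ℤ) ≤ q := by
    intro t
    simp only [F, Finset.mem_biUnion, Finset.mem_univ, true_and, Finset.mem_image, Finset.mem_Ico]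
    constructor
    · rintro ⟨i, q, ⟨h1, h2⟩, rfl⟩
      exact ⟨i, q, rfl, h2, h1⟩
    · rintro ⟨i, q, rfl, h2, h1⟩
      exact ⟨i, q, ⟨h1, h2⟩, rfl⟩
  have hcard : F.card = 3 * M := by
    rw [Finset.card_biUnion]
    · -- runner `i` contributes `c i + M` elements, and the `c i` sum to zero
      have h1 : ∀ i : Fin 3, (((Finset.Ico (-(M : ℤ)) (c i)).image
          fun q => 3 * q + ((i : ℕ) : ℤ)).card : ℤ) = c i + M := by
        intro i
        rw [Finset.card_image_of_injective _ fun a b h => by omega, Int.card_Ico]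
        have := hM i
        omega
      zify
      simp only [h1, Finset.sum_add_distrib, hc]
      simp
    · intro i _ k _ hik
      rw [Function.onFun, Finset.disjoint_left]
      simp only [Finset.mem_image]
      rintro _ ⟨q, _, rfl⟩ ⟨r, _, h⟩
      exact hik (Fin.ext (by omega))
  obtain ⟨μ, hμ⟩ := exists_beads_eq hcard (by
    intro t ht
    obtain ⟨i, q, rfl, _, h⟩ := (hF t).1 ht
    push_cast
    omega)
  refine ⟨μ, ?_⟩
  ext t
  obtain ⟨i, q, rfl⟩ := exists_runner t
  rw [hμ, hF, mem_flushBeads]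
  have hi := i.2
  have := hM i
  constructor
  · rintro (⟨k, r, h, hr, _⟩ | h)
    · obtain rfl : i = k := Fin.ext (by omega)
      obtain rfl : q = r := by omega
      exact hr
    · push_cast at h
      omega
  · intro h
    by_cases hq : -(M : ℤ) ≤ q
    · exact Or.inl ⟨i, q, rfl, h, hq⟩
    · right
      push_cast
      omega

theorem toTriple_injective : Function.Injective toTriple := by
  rintro ⟨a, b⟩ ⟨c, d⟩ h
  have h1 := congrFun h 1
  have h2 := congrFun h 2
  simp only [toTriple, Matrix.cons_val] at h1 h2
  rw [h1, h2]

theorem sum_toTriple (c : ℤ × ℤ) : ∑ i, toTriple c i = 0 := by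
  simp only [toTriple, Fin.sum_univ_three, Matrix.cons_val]
  ring

theorem card_of_beads_eq_toTriple {μ : YoungDiagram} {c : ℤ × ℤ}
    (h : beads μ = flushBeads (toTriple c)) :
    (μ.card : ℤ) = 3 * (c.1 ^ 2 + c.1 * c.2 + c.2 ^ 2) + c.1 + 2 * c.2 := by
  have := two_mul_card h
  simp [toTriple, Fin.sum_univ_three] at this
  linarith

/-- The pairs `(x, y)` for which `(-x - y, x, y)` is the characteristic vector of a 3-core of
size `n`. -/
def latticePoints (n : ℕ) : Set (ℤ × ℤ) :=
  {c | 3 * (c.1 ^ 2 + c.1 * c.2 + c.2 ^ 2) + c.1 + 2 * c.2 = (n : ℤ)}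

theorem mem_latticePoints {n : ℕ} {c : ℤ × ℤ} : c ∈ latticePoints n ↔
    3 * (c.1 ^ 2 + c.1 * c.2 + c.2 ^ 2) + c.1 + 2 * c.2 = (n : ℤ) := Iff.rfl

/-- The 3-cores of size `n` correspond to the lattice points of the conic `latticePoints n` through
their characteristic vectors. -/
theorem exists_equiv_latticePoints (n : ℕ) :
    ∃ e : threeCores n ≃ latticePoints n, ∀ μ : threeCores n, charVec μ = toTriple (e μ) := by
  have h1 : ∀ μ : threeCores n, ∃ c : latticePoints n, charVec μ = toTriple c := by
    rintro ⟨μ, hμ, hn⟩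
    have hb := beads_eq_flushBeads hμ
    have hs := sum_charVec hb
    have ht : charVec μ = toTriple (charVec μ 1, charVec μ 2) := by
      funext i
      rw [Fin.sum_univ_three] at hs
      fin_cases i <;> simp [toTriple]
      linarith
    rw [ht] at hb
    refine ⟨⟨_, ?_⟩, ht⟩
    rw [mem_latticePoints, ← card_of_beads_eq_toTriple hb, hn]
  choose f hf using h1
  refine ⟨Equiv.ofBijective f ⟨fun μ ν h => ?_, fun c => ?_⟩, hf⟩
  · exact Subtype.ext (charVec_injOn μ.2.1 ν.2.1 (by rw [hf, hf, h]))
  · obtain ⟨μ, hμ⟩ := exists_beads_eq_flushBeads (sum_toTriple c)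
    have hn : μ.card = n := by
      have := card_of_beads_eq_toTriple hμ
      have h2 := mem_latticePoints.1 c.2
      omega
    refine ⟨⟨μ, isThreeCore_of_beads_eq hμ, hn⟩, Subtype.ext (toTriple_injective ?_)⟩
    rw [← hf]
    exact charVec_eq hμ

theorem charVecs_eq_latticePoints (n : ℕ) : charVecs n = latticePoints n := by
  obtain ⟨e, he⟩ := exists_equiv_latticePoints n
  ext c
  constructor
  · rintro ⟨μ, hμ, h⟩
    rw [← toTriple_injective ((he ⟨μ, hμ⟩).symm.trans h)]
    exact (e ⟨μ, hμ⟩).2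
  · intro hc
    refine ⟨(e.symm ⟨c, hc⟩ : threeCores n), (e.symm ⟨c, hc⟩).2, ?_⟩
    rw [he, Equiv.apply_symm_apply]

/-! ### Coordinates and norm on the Eisenstein integers -/

theorem jRoot_eq : jRoot = (-1 + Complex.I * (Real.sqrt 3 : ℂ)) / 2 := by
  have h1 : jRoot = Complex.exp (((2 * Real.pi / 3 : ℝ) : ℂ) * Complex.I) := by
    unfold jRoot
    congr 1
    push_cast
    ring
  have h2 : 2 * Real.pi / 3 = Real.pi - Real.pi / 3 := by ring
  rw [h1, Complex.exp_mul_I, ← Complex.ofReal_cos, ← Complex.ofReal_sin, h2, Real.cos_pi_sub,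
    Real.sin_pi_sub, Real.cos_pi_div_three, Real.sin_pi_div_three]
  push_cast
  ring

theorem jRoot_sq : jRoot ^ 2 = -1 - jRoot := by
  have h : (Real.sqrt 3 : ℂ) ^ 2 = 3 := by
    rw [← Complex.ofReal_pow, Real.sq_sqrt (by norm_num)]
    norm_num
  rw [jRoot_eq]
  linear_combination (1 / 4 : ℂ) * Complex.I ^ 2 * h + (3 / 4 : ℂ) * Complex.I_sq

/-- The element `𝐣` of `ℤ[𝐣]`. -/
noncomputable def eisJ : Eis := ⟨jRoot, Algebra.subset_adjoin (Set.mem_singleton _)⟩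

/-- The element `a + b 𝐣` of `ℤ[𝐣]`. -/
noncomputable def eisMk (a b : ℤ) : Eis := (a : Eis) + (b : Eis) * eisJ

theorem eisJ_sq : eisJ ^ 2 = -1 - eisJ := Subtype.ext jRoot_sq

theorem eisMk_mul (a b c d : ℤ) :
    eisMk a b * eisMk c d = eisMk (a * c - b * d) (a * d + b * c - b * d) := by
  unfold eisMk
  push_cast
  linear_combination ((b : Eis) * d) * eisJ_sq

theorem eisMk_add (a b c d : ℤ) : eisMk a b + eisMk c d = eisMk (a + c) (b + d) := by
  unfold eisMk
  push_cast
  ring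

theorem eisMk_sub (a b c d : ℤ) : eisMk a b - eisMk c d = eisMk (a - c) (b - d) := by
  unfold eisMk
  push_cast
  ring

theorem eisMk_zero_right (a : ℤ) : eisMk a 0 = (a : Eis) := by simp [eisMk]

theorem coe_eisMk (a b : ℤ) : (eisMk a b : ℂ) = rho (2 * a - b, b) := by
  have : (eisMk a b : ℂ) = a + b * jRoot := by simp [eisMk, eisJ]
  rw [this, jRoot_eq, rho]
  push_cast
  ring

theorem rho_injective : Function.Injective rho := by
  rintro ⟨a, b⟩ ⟨c, d⟩ h
  have h1 := congrArg Complex.re h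
  have h2 := congrArg Complex.im h
  simp [rho] at h1 h2
  rw [h1, h2]

theorem eisMk_inj {a b c d : ℤ} : eisMk a b = eisMk c d ↔ a = c ∧ b = d := by
  constructor
  · intro h
    have h1 : rho (2 * a - b, b) = rho (2 * c - d, d) := by rw [← coe_eisMk, ← coe_eisMk, h]
    have h2 := Prod.mk.inj (rho_injective h1)
    omega
  · rintro ⟨rfl, rfl⟩
    rfl

theorem exists_eq_eisMk (z : Eis) : ∃ a b : ℤ, z = eisMk a b := by
  obtain ⟨z, hz⟩ := z
  suffices h : ∃ a b : ℤ, z = (eisMk a b : ℂ) by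
    obtain ⟨a, b, h⟩ := h
    exact ⟨a, b, Subtype.ext h⟩
  induction hz using Algebra.adjoin_induction with
  | mem x hx =>
    refine ⟨0, 1, ?_⟩
    rw [Set.mem_singleton_iff.1 hx]
    simp [eisMk, eisJ]
  | algebraMap r => exact ⟨r, 0, by simp [eisMk]⟩
  | add x y _ _ hx hy =>
    obtain ⟨a, b, rfl⟩ := hx
    obtain ⟨c, d, rfl⟩ := hy
    exact ⟨_, _, by rw [← eisMk_add]; rfl⟩
  | mul x y _ _ hx hy =>
    obtain ⟨a, b, rfl⟩ := hx
    obtain ⟨c, d, rfl⟩ := hy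
    exact ⟨_, _, by rw [← eisMk_mul]; rfl⟩

/-- Complex conjugation as a ring automorphism of `ℤ[𝐣]`. -/
noncomputable def eisConjEquiv : Eis ≃+* Eis where
  toFun := eisConj
  invFun := eisConj
  left_inv z := Subtype.ext (Complex.conj_conj (z : ℂ))
  right_inv z := Subtype.ext (Complex.conj_conj (z : ℂ))
  map_mul' z w := Subtype.ext (map_mul (starRingEnd ℂ) (z : ℂ) w)
  map_add' z w := Subtype.ext (map_add (starRingEnd ℂ) (z : ℂ) w)

theorem eisConjEquiv_apply (z : Eis) : eisConjEquiv z = eisConj z := rfl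

theorem eisConj_eisConj (z : Eis) : eisConj (eisConj z) = z := eisConjEquiv.left_inv z

theorem eisConj_eisMk (a b : ℤ) : eisConj (eisMk a b) = eisMk (a - b) (-b) := by
  have hj : eisConjEquiv eisJ = -1 - eisJ := by
    rw [← eisJ_sq]
    exact Subtype.ext conj_jRoot
  rw [← eisConjEquiv_apply, eisMk, eisMk, map_add, map_mul, map_intCast, map_intCast, hj]
  push_cast
  ring

/-- The integral basis `1, 𝐣` of `ℤ[𝐣]`. -/
noncomputable def eisBasis : Module.Basis (Fin 2) ℤ Eis :=
  Module.Basis.ofEquivFun (LinearEquiv.symm (LinearEquiv.ofBijective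
    ({ toFun := fun f => eisMk (f 0) (f 1)
       map_add' := fun f g => (eisMk_add _ _ _ _).symm
       map_smul' := fun r f => by
        simp only [Pi.smul_apply, smul_eq_mul, RingHom.id_apply, zsmul_eq_mul, eisMk]
        push_cast
        ring } : (Fin 2 → ℤ) →ₗ[ℤ] Eis)
    ⟨fun f g h => by
      have := eisMk_inj.1 h
      funext i
      fin_cases i
      exacts [this.1, this.2],
     fun z => by
      obtain ⟨a, b, rfl⟩ := exists_eq_eisMk z
      exact ⟨![a, b], rfl⟩⟩))

theorem eisBasis_repr (a b : ℤ) : ⇑(eisBasis.repr (eisMk a b)) = ![a, b] := by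
  rw [eisBasis, ← Module.Basis.equivFun_apply, Module.Basis.equivFun_ofEquivFun,
    LinearEquiv.symm_apply_eq]
  rfl

theorem eisBasis_zero : eisBasis 0 = eisMk 1 0 :=
  eisBasis.repr.injective (DFunLike.ext' (by
    rw [eisBasis_repr, Module.Basis.repr_self]
    ext i
    fin_cases i <;> simp))

theorem eisBasis_one : eisBasis 1 = eisMk 0 1 :=
  eisBasis.repr.injective (DFunLike.ext' (by
    rw [eisBasis_repr, Module.Basis.repr_self]
    ext i
    fin_cases i <;> simp))

instance : Module.Free ℤ Eis := Module.Free.of_basis eisBasis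

instance : Module.Finite ℤ Eis := Module.Finite.of_basis eisBasis

theorem norm_eisMk (a b : ℤ) : Algebra.norm ℤ (eisMk a b) = a ^ 2 - a * b + b ^ 2 := by
  rw [Algebra.norm_eq_matrix_det eisBasis, Matrix.det_fin_two]
  simp only [Algebra.leftMulMatrix_eq_repr_mul, eisBasis_zero, eisBasis_one, eisMk_mul,
    eisBasis_repr, Matrix.cons_val_zero, Matrix.cons_val_one]
  ring

/-- Both `eisNorm` and the algebra norm are `a² - a b + b²` in coordinates; the second one takes its
values in `ℤ` and is linked to ideal norms. -/
theorem eisNorm_eq_norm (z : Eis) : eisNorm z = (Algebra.norm ℤ z : Eis) := by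
  obtain ⟨a, b, rfl⟩ := exists_eq_eisMk z
  rw [eisNorm, eisConj_eisMk, eisMk_mul, norm_eisMk, ← eisMk_zero_right, eisMk_inj]
  constructor <;> ring

theorem mul_eisConj (z : Eis) : z * eisConj z = (Algebra.norm ℤ z : Eis) := eisNorm_eq_norm z

theorem eisNorm_eq_natCast {z : Eis} {m : ℕ} : eisNorm z = (m : Eis) ↔ Algebra.norm ℤ z = m := by
  rw [eisNorm_eq_norm, ← Int.cast_natCast (R := Eis), Int.cast_inj]

theorem norm_eis_nonneg (z : Eis) : 0 ≤ Algebra.norm ℤ z := by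
  obtain ⟨a, b, rfl⟩ := exists_eq_eisMk z
  rw [norm_eisMk]
  nlinarith [sq_nonneg (a - b), sq_nonneg a, sq_nonneg b]

theorem norm_eis_pos_iff {z : Eis} : 0 < Algebra.norm ℤ z ↔ z ≠ 0 := by
  rw [(norm_eis_nonneg z).lt_iff_ne, ne_comm, Algebra.norm_ne_zero_iff]

theorem norm_eisConj (z : Eis) : Algebra.norm ℤ (eisConj z) = Algebra.norm ℤ z := by
  obtain ⟨a, b, rfl⟩ := exists_eq_eisMk z
  rw [eisConj_eisMk, norm_eisMk, norm_eisMk]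
  ring

theorem norm_eis_natCast (k : ℕ) : Algebra.norm ℤ (k : Eis) = (k : ℤ) ^ 2 := by
  rw [← Int.cast_natCast, ← eisMk_zero_right, norm_eisMk]
  ring

theorem isUnit_iff_norm_eq_one {z : Eis} : IsUnit z ↔ Algebra.norm ℤ z = 1 := by
  constructor
  · intro h
    have h1 := h.map (Algebra.norm ℤ)
    have h2 := norm_eis_nonneg z
    rcases Int.isUnit_iff.1 h1 with h | h <;> omega
  · intro h
    refine IsUnit.of_mul_eq_one (eisConj z) ?_
    rw [mul_eisConj, h, Int.cast_one]

/-! ### Euclidean division and ideals -/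

theorem exists_two_mul_abs_sub_le (s : ℤ) {m : ℤ} (hm : 0 < m) : ∃ q : ℤ, 2 * |s - q * m| ≤ m := by
  have h1 := Int.emod_nonneg s hm.ne'
  have h2 := Int.emod_lt_of_pos s hm
  have h3 := Int.emod_add_mul_ediv s m
  by_cases h : 2 * (s % m) ≤ m
  · refine ⟨s / m, ?_⟩
    rw [show s - s / m * m = s % m by linarith, abs_of_nonneg h1]
    exact h
  · refine ⟨s / m + 1, ?_⟩
    rw [show s - (s / m + 1) * m = s % m - m by linarith, abs_of_nonpos (by linarith)]
    linarith

theorem exists_norm_sub_mul_lt (z : Eis) {w : Eis} (hw : w ≠ 0) :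
    ∃ q : Eis, Algebra.norm ℤ (z - q * w) < Algebra.norm ℤ w := by
  have hm := norm_eis_pos_iff.2 hw
  obtain ⟨s, t, hst⟩ := exists_eq_eisMk (z * eisConj w)
  obtain ⟨q, hq⟩ := exists_two_mul_abs_sub_le s hm
  obtain ⟨r, hr⟩ := exists_two_mul_abs_sub_le t hm
  refine ⟨eisMk q r, ?_⟩
  -- both coordinates of `(z - (q + r 𝐣) w) * conj w` are at most half the norm of `w`
  have h1 : (z - eisMk q r * w) * eisConj w =
      eisMk (s - q * Algebra.norm ℤ w) (t - r * Algebra.norm ℤ w) := by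
    rw [← eisMk_sub, ← hst, sub_mul, mul_assoc, mul_eisConj, ← eisMk_zero_right, eisMk_mul]
    congr 2 <;> ring
  have h2 := congrArg (Algebra.norm ℤ) h1
  rw [map_mul, norm_eisConj, norm_eisMk] at h2
  set m := Algebra.norm ℤ w
  set x := s - q * m
  set y := t - r * m
  -- `x² - x y + y² ≤ 3 m² / 4`
  have hx := abs_le.1 (show |2 * x| ≤ m by rw [abs_mul]; exact hq)
  have hy := abs_le.1 (show |2 * y| ≤ m by rw [abs_mul]; exact hr)
  nlinarith

instance : IsPrincipalIdealRing Eis where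
  principal I := by
    by_cases hI : I = ⊥
    · rw [hI]
      exact ⟨0, by simp⟩
    · obtain ⟨w₀, hw₀, hne⟩ := Submodule.exists_mem_ne_zero_of_ne_bot hI
      obtain ⟨w, ⟨hwI, hw⟩, hmin⟩ := WellFounded.has_min
        (measure fun z : Eis => (Algebra.norm ℤ z).toNat).wf {z | z ∈ I ∧ z ≠ 0} ⟨w₀, hw₀, hne⟩
      refine ⟨w, le_antisymm (fun z hz => ?_) ?_⟩
      · obtain ⟨q, hq⟩ := exists_norm_sub_mul_lt z hw
        have hr : z - q * w ∈ I := I.sub_mem hz (I.mul_mem_left q hwI)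
        have h0 : z - q * w = 0 := by
          by_contra h0
          refine hmin _ ⟨hr, h0⟩ ?_
          have := norm_eis_nonneg (z - q * w)
          change (Algebra.norm ℤ (z - q * w)).toNat < (Algebra.norm ℤ w).toNat
          omega
        exact Ideal.mem_span_singleton'.2 ⟨q, (sub_eq_zero.1 h0).symm⟩
      · exact (Submodule.span_singleton_le_iff_mem _ _).2 hwI

theorem card_quotient_span_singleton (z : Eis) :
    (Nat.card (Eis ⧸ Ideal.span {z}) : ℤ) = Algebra.norm ℤ z := by
  have h := Ideal.absNorm_span_singleton z
  rw [Ideal.absNorm_apply, Submodule.cardQuot_apply] at h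
  have := norm_eis_nonneg z
  rw [h]
  omega

/-! ### Primary elements -/

/-- The elements of `ℤ[𝐣]` congruent to `1 + 𝐣` modulo `3`. These are the elements of the form
`(u + v √(-3)) / 2` with `u ≡ v ≡ 1 (mod 3)`. -/
def IsPrimary (z : Eis) : Prop := ∃ a b : ℤ, z = eisMk a b ∧ a % 3 = 1 ∧ b % 3 = 1

theorem isPrimary_iff {z : Eis} :
    IsPrimary z ↔ ∃ u v : ℤ, u ≡ 1 [ZMOD 3] ∧ v ≡ 1 [ZMOD 3] ∧ (z : ℂ) = rho (u, v) := by
  simp only [Int.ModEq]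
  constructor
  · rintro ⟨a, b, rfl, ha, hb⟩
    exact ⟨2 * a - b, b, by omega, by omega, coe_eisMk a b⟩
  · rintro ⟨u, v, hu, hv, h⟩
    obtain ⟨a, b, rfl⟩ := exists_eq_eisMk z
    rw [coe_eisMk] at h
    have := Prod.mk.inj (rho_injective h)
    exact ⟨a, b, rfl, by omega, by omega⟩

theorem norm_emod_three {a b : ℤ} : (a ^ 2 - a * b + b ^ 2) % 3 = (a + b) ^ 2 % 3 := by
  have : a ^ 2 - a * b + b ^ 2 = (a + b) ^ 2 + 3 * (-(a * b)) := by ring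
  rw [this, Int.add_mul_emod_self_left]

/-- The six units represent the six residue classes prime to `3` modulo `3`. -/
theorem exists_unit_mul_isPrimary {z : Eis} (hz : ¬ (3 : ℤ) ∣ Algebra.norm ℤ z) :
    ∃ ξ : Eisˣ, IsPrimary (ξ * z) := by
  obtain ⟨a, b, rfl⟩ := exists_eq_eisMk z
  have hunit : ∀ s t : ℤ, s ^ 2 - s * t + t ^ 2 = 1 →
      (s * a - t * b) % 3 = 1 → (s * b + t * a - t * b) % 3 = 1 →
      ∃ ξ : Eisˣ, IsPrimary (ξ * eisMk a b) := by
    intro s t h1 h2 h3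
    have hu : IsUnit (eisMk s t) := isUnit_iff_norm_eq_one.2 (by rw [norm_eisMk, h1])
    exact ⟨hu.unit, _, _, by rw [IsUnit.unit_spec, eisMk_mul], h2, h3⟩
  have hab : (a + b) % 3 ≠ 0 := by
    intro h
    apply hz
    rw [norm_eisMk]
    apply Int.dvd_of_emod_eq_zero
    rw [norm_emod_three, pow_two, Int.mul_emod, h]
    rfl
  have h3a : a % 3 = 0 ∨ a % 3 = 1 ∨ a % 3 = 2 := by omega
  have h3b : b % 3 = 0 ∨ b % 3 = 1 ∨ b % 3 = 2 := by omega
  rcases h3a with ha | ha | ha <;> rcases h3b with hb | hb | hb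
  · omega
  · exact hunit 0 (-1) (by norm_num) (by omega) (by omega)
  · exact hunit 0 1 (by norm_num) (by omega) (by omega)
  · exact hunit 1 1 (by norm_num) (by omega) (by omega)
  · exact hunit 1 0 (by norm_num) (by omega) (by omega)
  · omega
  · exact hunit (-1) (-1) (by norm_num) (by omega) (by omega)
  · omega
  · exact hunit (-1) 0 (by norm_num) (by omega) (by omega)

theorem IsPrimary.eq_of_associated {z w : Eis} (hz : IsPrimary z) (hw : IsPrimary w)
    (h : Associated z w) : z = w := by
  obtain ⟨a, b, rfl, ha, hb⟩ := hz
  obtain ⟨c, d, rfl, hc, hd⟩ := hw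
  obtain ⟨ξ, hξ⟩ := h
  obtain ⟨s, t, hst⟩ := exists_eq_eisMk (ξ : Eis)
  have h1 := isUnit_iff_norm_eq_one.1 ξ.isUnit
  rw [hst, norm_eisMk] at h1
  rw [hst, eisMk_mul, eisMk_inj] at hξ
  obtain ⟨k, rfl⟩ : ∃ k, a = 3 * k + 1 := ⟨a / 3, by omega⟩
  obtain ⟨l, rfl⟩ : ∃ l, b = 3 * l + 1 := ⟨b / 3, by omega⟩
  have h2 : c = 3 * (k * s - l * t) + s - t := by rw [← hξ.1]; ring
  have h3 : d = 3 * (k * t + l * s - l * t) + s := by rw [← hξ.2]; ring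
  -- `4 = (2 s - t)² + 3 t²` bounds `t`, and `s ≡ 1`, `t ≡ 0` modulo `3`
  have ht1 : t ≤ 1 := by nlinarith [sq_nonneg (2 * s - t)]
  have ht2 : -1 ≤ t := by nlinarith [sq_nonneg (2 * s - t)]
  obtain rfl : t = 0 := by omega
  have hs1 : s ≤ 1 := by nlinarith
  have hs2 : -1 ≤ s := by nlinarith
  obtain rfl : s = 1 := by omega
  rw [eisMk_inj]
  omega

/-! ### Primes of the Eisenstein integers -/

theorem irreducible_of_norm_eq_prime {z : Eis} {p : ℕ} (hp : p.Prime)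
    (hz : Algebra.norm ℤ z = p) : Irreducible z := by
  refine ⟨fun h => ?_, fun a b hab => ?_⟩
  · rw [isUnit_iff_norm_eq_one, hz] at h
    exact hp.one_lt.ne' (by exact_mod_cast h)
  · have h : Irreducible (Algebra.norm ℤ a * Algebra.norm ℤ b) := by
      rw [← map_mul, ← hab, hz]
      exact (Nat.prime_iff_prime_int.1 hp).irreducible
    have ha := norm_eis_nonneg a
    have hb := norm_eis_nonneg b
    refine (h.isUnit_or_isUnit rfl).imp (fun h => ?_) fun h => ?_ <;>
    · rw [isUnit_iff_norm_eq_one]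
      rcases Int.isUnit_iff.1 h with h | h <;> omega

/-- A proper factor of a rational prime `p` has norm `p`. -/
theorem norm_eq_of_mul_eq_prime {a b : Eis} {p : ℕ} (hp : p.Prime) (h : (p : Eis) = a * b)
    (ha : ¬ IsUnit a) (hb : ¬ IsUnit b) : Algebra.norm ℤ a = p := by
  have h1 : Algebra.norm ℤ a * Algebra.norm ℤ b = (p : ℤ) ^ 2 := by
    rw [← map_mul, ← h, norm_eis_natCast]
  rw [isUnit_iff_norm_eq_one] at ha hb
  obtain ⟨k, hk⟩ := Int.eq_ofNat_of_zero_le (norm_eis_nonneg a)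
  obtain ⟨l, hl⟩ := Int.eq_ofNat_of_zero_le (norm_eis_nonneg b)
  rw [hk, hl] at h1
  have h2 : k * l = p ^ 2 := by exact_mod_cast h1
  rw [hk]
  congr 1
  exact ((Nat.Prime.mul_eq_prime_sq_iff hp (fun h => ha (by rw [hk, h]; rfl))
    (fun h => hb (by rw [hl, h]; rfl))).1 h2).1

/-- A prime `p ≡ 2 (mod 3)` is inert: no norm is congruent to `2` modulo `3`. -/
theorem prime_natCast_of_mod_eq_two {p : ℕ} (hp : p.Prime) (h3 : p % 3 = 2) :
    Prime (p : Eis) := by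
  rw [← irreducible_iff_prime]
  refine ⟨fun h => ?_, fun a b hab => ?_⟩
  · rw [isUnit_iff_norm_eq_one, norm_eis_natCast] at h
    have := hp.one_lt
    nlinarith
  · by_contra! h
    have h1 := norm_eq_of_mul_eq_prime hp hab h.1 h.2
    obtain ⟨s, t, rfl⟩ := exists_eq_eisMk a
    rw [norm_eisMk] at h1
    have h2 := norm_emod_three (a := s) (b := t)
    have h4 : (s + t) % 3 = 0 ∨ (s + t) % 3 = 1 ∨ (s + t) % 3 = 2 := by omega
    rw [h1, pow_two, Int.mul_emod] at h2
    rcases h4 with h4 | h4 | h4 <;> rw [h4] at h2 <;> omega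

/-- A prime `p ≡ 1 (mod 3)` splits: it divides `t² + t + 1 = (t - 𝐣) (t - 𝐣²)` for a `t` of order
three modulo `p`, but neither of the two factors. -/
theorem exists_norm_eq_of_mod_eq_one {p : ℕ} (hp : p.Prime) (h3 : p % 3 = 1) :
    ∃ z : Eis, Algebra.norm ℤ z = p := by
  have : Fact p.Prime := ⟨hp⟩
  obtain ⟨g, hg⟩ := exists_prime_orderOf_dvd_card (G := (ZMod p)ˣ) 3 (by
    rw [ZMod.card_units]
    have := hp.one_lt
    omega)
  have hg1 : (g : ZMod p) ≠ 1 := fun h => by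
    rw [Units.val_eq_one.1 h, orderOf_one] at hg
    omega
  have hg3 : (g : ZMod p) ^ 3 = 1 := by
    rw [← Units.val_pow_eq_pow_val, ← hg, pow_orderOf_eq_one, Units.val_one]
  have hg0 : (g : ZMod p) ^ 2 + g + 1 = 0 := by
    refine (mul_eq_zero.1 (?_ : ((g : ZMod p) - 1) * _ = 0)).resolve_left (sub_ne_zero.2 hg1)
    linear_combination hg3
  obtain ⟨t, ht⟩ := ZMod.intCast_surjective (g : ZMod p)
  have hdvd : (p : ℤ) ∣ t ^ 2 + t + 1 := by
    rw [← ZMod.intCast_zmod_eq_zero_iff_dvd]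
    push_cast
    rw [ht, hg0]
  -- an element with coordinate `±1` along `𝐣` is not divisible by `p`
  have hnot : ∀ s e : ℤ, e ^ 2 = 1 → ¬ (p : Eis) ∣ eisMk s e := by
    rintro s e he ⟨w, hw⟩
    obtain ⟨c, d, rfl⟩ := exists_eq_eisMk w
    rw [← Int.cast_natCast, ← eisMk_zero_right, eisMk_mul, eisMk_inj] at hw
    have h1 : (p : ℤ) ∣ 1 := ⟨d * e, by rw [← he, pow_two]; nth_rw 1 [hw.2]; ring⟩
    exact hp.one_lt.ne' (by exact_mod_cast Int.eq_one_of_dvd_one (by positivity) h1)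
  have hprime : ¬ Prime (p : Eis) := by
    intro h
    have h1 : (p : Eis) ∣ eisMk t (-1) * eisMk (t + 1) 1 := by
      rw [eisMk_mul, show t * 1 + -1 * (t + 1) - -1 * 1 = 0 by ring, eisMk_zero_right,
        ← Int.cast_natCast]
      exact Int.cast_dvd_cast _ _ (by convert hdvd using 1; ring)
    rcases h.dvd_or_dvd h1 with h | h
    · exact hnot _ _ (by norm_num) h
    · exact hnot _ _ (by norm_num) h
  rw [← irreducible_iff_prime, irreducible_iff] at hprime
  push Not at hprime
  obtain ⟨a, b, hab, ha, hb⟩ := hprime (by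
    rw [isUnit_iff_norm_eq_one, norm_eis_natCast]
    have := hp.one_lt
    nlinarith)
  exact ⟨a, norm_eq_of_mul_eq_prime hp hab ha hb⟩

/-- The two primes above `p ≡ 1 (mod 3)` are not associated: otherwise `p` would ramify. -/
theorem not_dvd_eisConj {p : ℕ} (hp : p.Prime) (h3 : p % 3 = 1) {x : Eis}
    (hx : Algebra.norm ℤ x = p) : ¬ x ∣ eisConj x := by
  intro h
  have hpi := Nat.prime_iff_prime_int.1 hp
  have h1 : x ∣ x + eisConj x := dvd_add dvd_rfl h
  obtain ⟨a, b, rfl⟩ := exists_eq_eisMk x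
  have h2 := map_dvd (Algebra.norm ℤ) h1
  rw [hx, eisConj_eisMk, eisMk_add, norm_eisMk] at h2
  rw [norm_eisMk] at hx
  -- `p` divides the trace `2 a - b`, hence `b` by `4 p = (2 a - b)² + 3 b²`, and then `p² ∣ 4 p`
  have h4 : (p : ℤ) ∣ 2 * a - b := hpi.dvd_of_dvd_pow (n := 2) (by convert h2 using 1; ring)
  have hp3 : ¬ (p : ℤ) ∣ 3 := by
    intro h
    have : p ∣ 3 := by exact_mod_cast h
    rw [Nat.prime_dvd_prime_iff_eq hp Nat.prime_three] at this
    omega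
  have hp4 : ¬ (p : ℤ) ∣ 4 := by
    intro h
    have : p ∣ 2 ^ 2 := by exact_mod_cast h
    have := (Nat.prime_dvd_prime_iff_eq hp Nat.prime_two).1 (hp.dvd_of_dvd_pow this)
    omega
  have h5 : (p : ℤ) ∣ b := by
    refine hpi.dvd_of_dvd_pow (n := 2) ((hpi.dvd_or_dvd ?_).resolve_left hp3)
    have : 3 * b ^ 2 = p * 4 - (2 * a - b) ^ 2 := by rw [← hx]; ring
    rw [this]
    exact dvd_sub (dvd_mul_right _ _) (dvd_pow h4 two_ne_zero)
  have h6 : (p : ℤ) ^ 2 ∣ p * 4 := by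
    have : (p : ℤ) * 4 = (2 * a - b) ^ 2 + 3 * b ^ 2 := by rw [← hx]; ring
    rw [this]
    exact dvd_add (pow_dvd_pow_of_dvd h4 2) (dvd_mul_of_dvd_right (pow_dvd_pow_of_dvd h5 2) 3)
  rw [pow_two, mul_dvd_mul_iff_left hpi.ne_zero] at h6
  exact hp4 h6

/-! ### Valuations -/

/-- The valuation at an unramified prime of `ℤ[𝐣]` extends the `p`-adic valuation. -/
theorem emultiplicity_natCast {π : Eis} (hπ : Prime π) {p : ℕ} (hp : p.Prime)
    (h1 : emultiplicity π (p : Eis) = 1) {m : ℕ} (hm : m ≠ 0) :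
    emultiplicity π (m : Eis) = padicValNat p m := by
  obtain ⟨e, k, hk, rfl⟩ := Nat.exists_eq_pow_mul_and_not_dvd hm p hp.ne_one
  have : Fact p.Prime := ⟨hp⟩
  have hk0 : k ≠ 0 := by
    rintro rfl
    exact hk (dvd_zero _)
  have hπk : ¬ π ∣ (k : Eis) := by
    intro h
    have hco : IsCoprime (p : ℤ) (k : ℤ) :=
      Nat.isCoprime_iff_coprime.2 ((Nat.Prime.coprime_iff_not_dvd hp).2 hk)
    have hco' : IsCoprime (p : Eis) (k : Eis) := by
      simpa using hco.map (Int.castRingHom Eis)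
    have hπp : π ∣ (p : Eis) := dvd_of_emultiplicity_pos (by rw [h1]; exact one_pos)
    exact hπ.not_isUnit (hco'.isUnit_of_dvd' hπp h)
  rw [Nat.cast_mul, Nat.cast_pow, emultiplicity_mul hπ, emultiplicity_pow hπ, h1, mul_one,
    emultiplicity_eq_zero.2 hπk, add_zero, padicValNat.mul (pow_ne_zero _ hp.ne_zero) hk0,
    padicValNat.prime_pow, padicValNat.eq_zero_of_not_dvd hk, add_zero]

theorem emultiplicity_eisConj (π z : Eis) :
    emultiplicity (eisConj π) (eisConj z) = emultiplicity π z :=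
  emultiplicity_map_eq eisConjEquiv

/-- At the primes above `p`, the valuation of the norm of `z` is the sum of the valuations of `z` at
`π` and at its conjugate. -/
theorem emultiplicity_add_emultiplicity {π : Eis} (hπ : Prime π) {p : ℕ} (hp : p.Prime)
    (h1 : emultiplicity π (p : Eis) = 1) {z : Eis} {m : ℕ} (hm : m ≠ 0)
    (hz : Algebra.norm ℤ z = m) :
    emultiplicity π z + emultiplicity (eisConj π) z = padicValNat p m := by
  rw [← emultiplicity_natCast hπ hp h1 hm, ← Int.cast_natCast, ← hz, ← mul_eisConj,
    emultiplicity_mul hπ, ← emultiplicity_eisConj (eisConj π) z, eisConj_eisConj]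

theorem prime_of_norm_eq_prime {x : Eis} {p : ℕ} (hp : p.Prime) (hx : Algebra.norm ℤ x = p) :
    Prime x :=
  (irreducible_of_norm_eq_prime hp hx).prime

theorem emultiplicity_self_of_prime {π : Eis} (hπ : Prime π) : emultiplicity π π = 1 :=
  (FiniteMultiplicity.of_not_isUnit hπ.not_isUnit hπ.ne_zero).emultiplicity_self

theorem emultiplicity_natCast_of_norm_eq {x : Eis} {p : ℕ} (hp : p.Prime) (h3 : p % 3 = 1)
    (hx : Algebra.norm ℤ x = p) : emultiplicity x (p : Eis) = 1 := by
  have hpr := prime_of_norm_eq_prime hp hx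
  rw [← Int.cast_natCast, ← hx, ← mul_eisConj, emultiplicity_mul hpr,
    emultiplicity_self_of_prime hpr, emultiplicity_eq_zero.2 (not_dvd_eisConj hp h3 hx), add_zero]

theorem eisConj_natCast (k : ℕ) : eisConj (k : Eis) = (k : Eis) := map_natCast eisConjEquiv k

theorem emultiplicity_add_self {p : ℕ} (hp : p.Prime) (h3 : p % 3 = 2) {z : Eis} {m : ℕ}
    (hm : m ≠ 0) (hz : Algebra.norm ℤ z = m) :
    emultiplicity (p : Eis) z + emultiplicity (p : Eis) z = padicValNat p m := by
  have hpr := prime_natCast_of_mod_eq_two hp h3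
  have := emultiplicity_add_emultiplicity hpr hp (emultiplicity_self_of_prime hpr) hm hz
  rwa [eisConj_natCast] at this

/-- The norms have even valuation at the primes `p ≡ 2 (mod 3)`. -/
theorem even_padicValNat_of_norm_eq {p : ℕ} (hp : p.Prime) (h3 : p % 3 = 2) {z : Eis} {m : ℕ}
    (hm : m ≠ 0) (hz : Algebra.norm ℤ z = m) : Even (padicValNat p m) := by
  have h := emultiplicity_add_self hp h3 hm hz
  have hfin : emultiplicity (p : Eis) z ≠ ⊤ := fun h' => by simp [h'] at h
  obtain ⟨e, he⟩ := ENat.ne_top_iff_exists.1 hfin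
  rw [← he] at h
  exact ⟨e, by exact_mod_cast h.symm⟩

theorem exists_prime_dvd_natCast {π : Eis} (hπ : Prime π) {m : ℕ} (hm : m ≠ 0)
    (h : π ∣ (m : Eis)) : ∃ p : ℕ, p.Prime ∧ p ∣ m ∧ π ∣ (p : Eis) := by
  rw [← Nat.prod_primeFactorsList hm, Nat.cast_list_prod, hπ.dvd_prod_iff] at h
  obtain ⟨a, ha, hπa⟩ := h
  obtain ⟨p, hp, rfl⟩ := List.mem_map.1 ha
  exact ⟨p, Nat.prime_of_mem_primeFactorsList hp, Nat.dvd_of_mem_primeFactorsList hp, hπa⟩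

/-- An element of norm prime to `3` is determined up to a unit by its norm and its valuations at one
of the two primes above each `p ≡ 1 (mod 3)`: the norm determines all the other valuations. -/
theorem dvd_of_emultiplicity_eq {x : PrimesMod 1 → Eis} (hx : ∀ p, Algebra.norm ℤ (x p) = (p : ℕ))
    {z w : Eis} {m : ℕ} (hm : m ≠ 0) (h3 : ¬ 3 ∣ m) (hz : Algebra.norm ℤ z = m)
    (hw : Algebra.norm ℤ w = m) (h : ∀ p, emultiplicity (x p) z = emultiplicity (x p) w) :
    z ∣ w := by
  have hz0 : z ≠ 0 := norm_eis_pos_iff.1 (by rw [hz]; exact_mod_cast Nat.pos_of_ne_zero hm)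
  rw [UniqueFactorizationMonoid.dvd_iff_emultiplicity_le hz0]
  intro π hπ
  by_cases hπz : π ∣ z
  swap
  · rw [emultiplicity_eq_zero.2 hπz]
    exact zero_le
  have hπm : π ∣ (m : Eis) := by
    rw [← Int.cast_natCast, ← hz, ← mul_eisConj]
    exact dvd_mul_of_dvd_left hπz _
  obtain ⟨p, hp, hpm, hπp⟩ := exists_prime_dvd_natCast hπ hm hπm
  have hp3 : p % 3 ≠ 0 := by
    intro h0
    rw [(Nat.prime_dvd_prime_iff_eq Nat.prime_three hp).1 (Nat.dvd_of_mod_eq_zero h0)] at h3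
    exact h3 hpm
  obtain hp1 | hp2 : p % 3 = 1 ∨ p % 3 = 2 := by omega
  · have hxp := hx ⟨p, hp, hp1⟩
    have hhp := h ⟨p, hp, hp1⟩
    set y := x ⟨p, hp, hp1⟩
    simp only at hxp
    have hy := prime_of_norm_eq_prime hp hxp
    have hy' : Prime (eisConj y) := prime_of_norm_eq_prime hp (by rw [norm_eisConj, hxp])
    rw [← Int.cast_natCast, ← hxp, ← mul_eisConj] at hπp
    rcases hπ.dvd_or_dvd hπp with hd | hd
    · have := (hπ.associated_of_dvd hy hd).symm
      rw [emultiplicity_eq_of_associated_left this, emultiplicity_eq_of_associated_left this, hhp]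
    · have := (hπ.associated_of_dvd hy' hd).symm
      rw [emultiplicity_eq_of_associated_left this, emultiplicity_eq_of_associated_left this]
      have h1 := emultiplicity_natCast_of_norm_eq hp hp1 hxp
      have h2 := emultiplicity_add_emultiplicity hy hp h1 hm hz
      have h3 := emultiplicity_add_emultiplicity hy hp h1 hm hw
      rw [← h2, hhp] at h3
      have hfin : emultiplicity y w ≠ ⊤ := fun h' => by simp [hhp, h'] at h2
      exact (WithTop.add_left_cancel hfin h3).ge
  · have := (hπ.associated_of_dvd (prime_natCast_of_mod_eq_two hp hp2) hπp).symm
    rw [emultiplicity_eq_of_associated_left this, emultiplicity_eq_of_associated_left this]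
    have h1 := emultiplicity_add_self hp hp2 hm hz
    have h2 := emultiplicity_add_self hp hp2 hm hw
    by_contra! hlt
    exact (WithTop.add_lt_add hlt hlt).ne (h2.trans h1.symm)

/-! ### The elements `y_j` -/

theorem finite_padicValNat_ne_zero {m : ℕ} (hm : m ≠ 0) (r : ℕ) :
    {p : PrimesMod r | padicValNat p m ≠ 0}.Finite := by
  refine ((Set.finite_Iic m).preimage (f := fun p : PrimesMod r => (p : ℕ))
    Subtype.val_injective.injOn).subset ?_
  intro p hp
  exact Nat.le_of_dvd (Nat.pos_of_ne_zero hm)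
    (dvd_of_one_le_padicValNat (Nat.one_le_iff_ne_zero.2 hp))

theorem finprod_primesMod_eq_prod {m : ℕ} (r : ℕ) :
    ∏ᶠ p : PrimesMod r, (p : ℕ) ^ padicValNat p m =
      ∏ p ∈ m.primeFactors with p % 3 = r, p ^ padicValNat p m := by
  rw [finprod_subtype_eq_finprod_cond (f := fun p : ℕ => p ^ padicValNat p m)]
  refine finprod_cond_eq_prod_of_cond_iff _ fun {p} hp => ?_
  rw [Finset.mem_filter, Nat.mem_primeFactors]
  have h0 : padicValNat p m ≠ 0 := fun h => hp (by rw [h, pow_zero])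
  have h1 : m ≠ 0 := by
    rintro rfl
    simp at h0
  have h2 := dvd_of_one_le_padicValNat (Nat.one_le_iff_ne_zero.2 h0)
  tauto

/-- The factorization of an integer prime to `3`. -/
theorem finprod_mul_finprod_eq {m : ℕ} (hm : m ≠ 0) (h3 : ¬ 3 ∣ m) :
    (∏ᶠ p : PrimesMod 1, (p : ℕ) ^ padicValNat p m) *
      ∏ᶠ p : PrimesMod 2, (p : ℕ) ^ padicValNat p m = m := by
  rw [finprod_primesMod_eq_prod, finprod_primesMod_eq_prod]
  have h2 : m.primeFactors.filter (fun p => p % 3 = 2) =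
      m.primeFactors.filter (fun p => ¬ p % 3 = 1) := by
    refine Finset.filter_congr fun p hp => ?_
    have hpp := Nat.prime_of_mem_primeFactors hp
    have : p % 3 ≠ 0 := by
      intro h0
      rw [(Nat.prime_dvd_prime_iff_eq Nat.prime_three hpp).1 (Nat.dvd_of_mod_eq_zero h0)] at h3
      exact h3 (Nat.dvd_of_mem_primeFactors hp)
    omega
  rw [h2, Finset.prod_filter_mul_prod_filter_not]
  conv_rhs => rw [← Nat.prod_factorization_pow_eq_self hm, Finsupp.prod, Nat.support_factorization]
  refine Finset.prod_congr rfl fun p hp => ?_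
  rw [Nat.factorization_def _ (Nat.prime_of_mem_primeFactors hp)]

theorem hasFiniteMulSupport_xElem {x : PrimesMod 1 → Eis} {n : ℕ} {j : PrimesMod 1 → ℕ}
    (hj : j ∈ exponents n) : Function.HasFiniteMulSupport fun p : PrimesMod 1 =>
      x p ^ j p * eisConj (x p) ^ (padicValNat p (3 * n + 1) - j p) := by
  refine (finite_padicValNat_ne_zero (Nat.succ_ne_zero (3 * n)) 1).subset fun p hp h => hp ?_
  have := hj p
  rw [Nat.succ_eq_add_one] at h
  simp only
  rw [h, show j p = 0 by omega]
  simp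

theorem hasFiniteMulSupport_qElem (n : ℕ) : Function.HasFiniteMulSupport fun p : PrimesMod 2 =>
    (p : ℕ) ^ (padicValNat p (3 * n + 1) / 2) := by
  refine (finite_padicValNat_ne_zero (Nat.succ_ne_zero (3 * n)) 2).subset fun p hp h => hp ?_
  rw [Nat.succ_eq_add_one] at h
  simp [h]

theorem qElem_sq {n : ℕ} (h : ∀ p : PrimesMod 2, Even (padicValNat p (3 * n + 1))) :
    qElem n ^ 2 = ∏ᶠ p : PrimesMod 2, (p : ℕ) ^ padicValNat p (3 * n + 1) := by
  rw [qElem, finprod_pow (hasFiniteMulSupport_qElem n)]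
  refine finprod_congr fun p => ?_
  rw [← pow_mul, Nat.div_mul_cancel (h p).two_dvd]

theorem norm_xElem {x : PrimesMod 1 → Eis} (hx : ∀ p, Algebra.norm ℤ (x p) = (p : ℕ)) {n : ℕ}
    {j : PrimesMod 1 → ℕ} (hj : j ∈ exponents n) :
    Algebra.norm ℤ (xElem x n j) =
      ((∏ᶠ p : PrimesMod 1, (p : ℕ) ^ padicValNat p (3 * n + 1) : ℕ) : ℤ) := by
  have h1 := MonoidHom.map_finprod (Algebra.norm ℤ (S := Eis))
    (hasFiniteMulSupport_xElem (x := x) hj)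
  have h2 := MonoidHom.map_finprod (Nat.castRingHom ℤ).toMonoidHom
    (f := fun p : PrimesMod 1 => (p : ℕ) ^ padicValNat p (3 * n + 1))
    ((finite_padicValNat_ne_zero (Nat.succ_ne_zero (3 * n)) 1).subset fun p hp h => hp (by
      rw [Nat.succ_eq_add_one] at h
      simp [h]))
  refine h1.trans (Eq.trans (finprod_congr fun p => ?_) h2.symm)
  rw [map_mul, map_pow, map_pow, norm_eisConj, hx, ← pow_add, Nat.add_sub_cancel' (hj p)]
  simp

theorem norm_yElem {x : PrimesMod 1 → Eis} (hx : ∀ p, Algebra.norm ℤ (x p) = (p : ℕ)) {n : ℕ}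
    (h : ∀ p : PrimesMod 2, Even (padicValNat p (3 * n + 1)))
    {j : PrimesMod 1 → ℕ} (hj : j ∈ exponents n) :
    Algebra.norm ℤ (yElem x n j) = ((3 * n + 1 : ℕ) : ℤ) := by
  rw [yElem, map_mul, norm_eis_natCast, norm_xElem hx hj]
  have h1 := finprod_mul_finprod_eq (m := 3 * n + 1) (by omega) (by omega)
  rw [← qElem_sq h] at h1
  conv_rhs => rw [← h1]
  push_cast
  ring

/-- The cofactor of `x_p ^ j_p` in `y_j` is prime to `x_p`: apart from the powers of `conj x_p`, its
norm is prime to `p`. -/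
theorem emultiplicity_yElem {x : PrimesMod 1 → Eis} (hx : ∀ p, Algebra.norm ℤ (x p) = (p : ℕ))
    {n : ℕ} (h : ∀ p : PrimesMod 2, Even (padicValNat p (3 * n + 1)))
    {j : PrimesMod 1 → ℕ} (hj : j ∈ exponents n) (p : PrimesMod 1) :
    emultiplicity (x p) (yElem x n j) = j p := by
  have hp := p.2.1
  have : Fact (p : ℕ).Prime := ⟨hp⟩
  have hpr := prime_of_norm_eq_prime hp (hx p)
  obtain ⟨r, hr⟩ : x p ^ j p * eisConj (x p) ^ (padicValNat p (3 * n + 1) - j p) ∣ yElem x n j :=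
    dvd_mul_of_dvd_right (finprod_mem_dvd p (hasFiniteMulSupport_xElem hj)) _
  have hnorm := norm_yElem hx h hj
  rw [hr, map_mul, map_mul, map_pow, map_pow, norm_eisConj, hx, ← pow_add,
    Nat.add_sub_cancel' (hj p)] at hnorm
  have hr' : ¬ x p ∣ r := by
    intro hd
    have h1 := map_dvd (Algebra.norm ℤ) hd
    rw [hx] at h1
    have h2 : ((p : ℕ) : ℤ) ^ (padicValNat p (3 * n + 1) + 1) ∣ ((3 * n + 1 : ℕ) : ℤ) := by
      rw [← hnorm, pow_succ]
      exact mul_dvd_mul_left _ h1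
    exact pow_succ_padicValNat_not_dvd (p := p) (n := 3 * n + 1) (by omega) (by exact_mod_cast h2)
  have hc := not_dvd_eisConj hp p.2.2 (hx p)
  rw [hr, emultiplicity_mul hpr, emultiplicity_mul hpr, emultiplicity_pow hpr,
    emultiplicity_pow hpr, emultiplicity_self_of_prime hpr, emultiplicity_eq_zero.2 hc,
    emultiplicity_eq_zero.2 hr']
  simp

/-- Every element of norm `3 n + 1` is associated to exactly one `y_j`. -/
theorem exists_associated_yElem {x : PrimesMod 1 → Eis}
    (hx : ∀ p, Algebra.norm ℤ (x p) = (p : ℕ)) {n : ℕ}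
    (h : ∀ p : PrimesMod 2, Even (padicValNat p (3 * n + 1))) {z : Eis}
    (hz : Algebra.norm ℤ z = ((3 * n + 1 : ℕ) : ℤ)) :
    ∃ j ∈ exponents n, Associated (yElem x n j) z := by
  have hm : 3 * n + 1 ≠ 0 := by omega
  have h3 : ¬ 3 ∣ 3 * n + 1 := by omega
  have hz0 : z ≠ 0 := norm_eis_pos_iff.1 (by rw [hz]; positivity)
  have hv : ∀ p, ∃ e : ℕ, emultiplicity (x p) z = e ∧ e ≤ padicValNat p (3 * n + 1) := by
    intro p
    have hpr := prime_of_norm_eq_prime p.2.1 (hx p)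
    have h1 := emultiplicity_add_emultiplicity hpr p.2.1
      (emultiplicity_natCast_of_norm_eq p.2.1 p.2.2 (hx p)) hm hz
    have h2 := (FiniteMultiplicity.of_not_isUnit hpr.not_isUnit hz0).emultiplicity_eq_multiplicity
    refine ⟨_, h2, ?_⟩
    rw [h2] at h1
    have h4 : ((multiplicity (x p) z : ℕ) : ℕ∞) ≤ padicValNat p (3 * n + 1) := by
      rw [← h1]
      exact le_self_add
    exact_mod_cast h4
  choose j hj1 hj2 using hv
  have heq : ∀ p, emultiplicity (x p) (yElem x n j) = emultiplicity (x p) z := fun p => by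
    rw [emultiplicity_yElem hx h hj2, hj1]
  exact ⟨j, hj2, associated_of_dvd_dvd
    (dvd_of_emultiplicity_eq hx hm h3 (norm_yElem hx h hj2) hz heq)
    (dvd_of_emultiplicity_eq hx hm h3 hz (norm_yElem hx h hj2) fun p => (heq p).symm)⟩

theorem eq_of_associated_yElem {x : PrimesMod 1 → Eis}
    (hx : ∀ p, Algebra.norm ℤ (x p) = (p : ℕ)) {n : ℕ}
    (h : ∀ p : PrimesMod 2, Even (padicValNat p (3 * n + 1))) {j k : PrimesMod 1 → ℕ}
    (hj : j ∈ exponents n) (hk : k ∈ exponents n)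
    (hjk : Associated (yElem x n j) (yElem x n k)) : j = k := by
  funext p
  have h1 := emultiplicity_eq_of_associated_right (a := x p) hjk
  rw [emultiplicity_yElem hx h hj, emultiplicity_yElem hx h hk] at h1
  exact_mod_cast h1

theorem card_exponents (n : ℕ) :
    Nat.card (exponents n) = ∏ᶠ p : PrimesMod 1, (padicValNat p (3 * n + 1) + 1) := by
  classical
  have hfin := finite_padicValNat_ne_zero (Nat.succ_ne_zero (3 * n)) 1
  let f : PrimesMod 1 →₀ ℕ := Finsupp.ofSupportFinite (fun p => padicValNat p (3 * n + 1)) hfin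
  have hf : ∀ p, f p = padicValNat p (3 * n + 1) := fun p => rfl
  have hcard : Nat.card (exponents n) = (Finset.Iic f).card := by
    have hsupp : ∀ j ∈ exponents n, j.HasFiniteSupport := fun j hj =>
      hfin.subset fun p hp h => hp (Nat.le_zero.1 ((hj p).trans h.le))
    let e : exponents n ≃ Finset.Iic f :=
      { toFun := fun j => ⟨Finsupp.ofSupportFinite j (hsupp j j.2), Finset.mem_Iic.2 fun p => j.2 p⟩
        invFun := fun g => ⟨g, fun p => Finset.mem_Iic.1 g.2 p⟩
        left_inv := fun j => rfl
        right_inv := fun g => Subtype.ext (Finsupp.ext fun p => rfl) }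
    rw [Nat.card_congr e, Nat.card_eq_fintype_card, Fintype.card_coe]
  rw [hcard, Finsupp.card_Iic]
  symm
  refine (finprod_eq_prod_of_mulSupport_subset _ ?_).trans (Finset.prod_congr rfl fun p _ => ?_)
  · intro p hp
    rw [Finset.mem_coe, Finsupp.mem_support_iff, hf]
    intro h
    exact hp (by simp only [h, zero_add])
  · rw [Nat.card_Iic, hf]

/-! ### From characteristic vectors to primary elements and ideals -/

theorem theta_injective : Function.Injective theta := by
  rintro ⟨a, b⟩ ⟨c, d⟩ h
  have := Prod.mk.inj h
  simp only [Prod.mk.injEq] at this ⊢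
  omega

theorem theta_mem_solutions {n : ℕ} {c : ℤ × ℤ} (hc : c ∈ latticePoints n) :
    theta c ∈ solutions (12 * n + 4) := by
  have h := mem_latticePoints.1 hc
  change (6 * c.1 + 3 * c.2 + 1) ^ 2 + 3 * (3 * c.2 + 1) ^ 2 = ((12 * n + 4 : ℕ) : ℤ)
  push_cast
  rw [← h]
  ring

theorem coe_eisMk_eq_rho_theta (c : ℤ × ℤ) :
    (eisMk (3 * c.1 + 3 * c.2 + 1) (3 * c.2 + 1) : ℂ) = rho (theta c) := by
  rw [coe_eisMk, theta]
  congr 2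
  ring

theorem norm_eisMk_eq_iff {n : ℕ} {c : ℤ × ℤ} :
    Algebra.norm ℤ (eisMk (3 * c.1 + 3 * c.2 + 1) (3 * c.2 + 1)) = ((3 * n + 1 : ℕ) : ℤ) ↔
      c ∈ latticePoints n := by
  rw [norm_eisMk, mem_latticePoints]
  push_cast
  constructor <;> intro h <;> linarith

/-- The elements of `ℤ[𝐣]` of norm `3 n + 1` in the residue class of `1 + 𝐣` modulo `3`. -/
abbrev PrimaryOfNorm (n : ℕ) : Type :=
  {z : Eis // Algebra.norm ℤ z = ((3 * n + 1 : ℕ) : ℤ) ∧ IsPrimary z}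

/-- Completing the square: the lattice points are the primary elements of norm `3 n + 1`. -/
theorem exists_equiv_primaryOfNorm (n : ℕ) :
    ∃ e : threeCores n ≃ PrimaryOfNorm n, ∀ μ : threeCores n, ∃ c ∈ latticePoints n,
      charVec μ = toTriple c ∧ ((e μ : Eis) : ℂ) = rho (theta c) := by
  obtain ⟨e, he⟩ := exists_equiv_latticePoints n
  let f : latticePoints n → PrimaryOfNorm n := fun c =>
    ⟨eisMk (3 * c.1.1 + 3 * c.1.2 + 1) (3 * c.1.2 + 1), norm_eisMk_eq_iff.2 c.2, _, _, rfl,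
      by omega, by omega⟩
  have hf : Function.Bijective f := by
    constructor
    · intro c d h
      have := eisMk_inj.1 (congrArg Subtype.val h)
      refine Subtype.ext (Prod.ext ?_ ?_) <;> omega
    · rintro ⟨_, hz, a, b, rfl, ha, hb⟩
      have ha' : a = 3 * ((a - b) / 3) + 3 * ((b - 1) / 3) + 1 := by omega
      have hb' : b = 3 * ((b - 1) / 3) + 1 := by omega
      refine ⟨⟨((a - b) / 3, (b - 1) / 3), norm_eisMk_eq_iff.1 ?_⟩, Subtype.ext ?_⟩
      · rw [← ha', ← hb']
        exact hz
      · exact eisMk_inj.2 ⟨ha'.symm, hb'.symm⟩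
  exact ⟨e.trans (Equiv.ofBijective f hf), fun μ =>
    ⟨e μ, (e μ).2, he μ, coe_eisMk_eq_rho_theta _⟩⟩

theorem not_three_dvd_norm {n : ℕ} {z : Eis} (hz : Algebra.norm ℤ z = ((3 * n + 1 : ℕ) : ℤ)) :
    ¬ (3 : ℤ) ∣ Algebra.norm ℤ z := by
  rw [hz]
  omega

/-- Every ideal of norm `3 n + 1` is principal with a unique primary generator. -/
theorem exists_equiv_ideals (n : ℕ) :
    ∃ e : PrimaryOfNorm n ≃ {I : Ideal Eis // Nat.card (Eis ⧸ I) = 3 * n + 1},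
      ∀ z, (e z : Ideal Eis) = Ideal.span {(z : Eis)} := by
  let f : PrimaryOfNorm n → {I : Ideal Eis // Nat.card (Eis ⧸ I) = 3 * n + 1} := fun z =>
    ⟨Ideal.span {(z : Eis)}, by
      have := card_quotient_span_singleton (z : Eis)
      rw [z.2.1] at this
      exact_mod_cast this⟩
  refine ⟨Equiv.ofBijective f ⟨fun z w h => ?_, fun I => ?_⟩, fun z => rfl⟩
  · exact Subtype.ext (z.2.2.eq_of_associated w.2.2
      (Ideal.span_singleton_eq_span_singleton.1 (congrArg Subtype.val h)))
  · obtain ⟨I, hI⟩ := I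
    obtain ⟨w, rfl⟩ := (IsPrincipalIdealRing.principal I).principal
    rw [Ideal.submodule_span_eq] at hI
    have hw : Algebra.norm ℤ w = ((3 * n + 1 : ℕ) : ℤ) := by
      rw [← card_quotient_span_singleton, hI]
    obtain ⟨ξ, hξ⟩ := exists_unit_mul_isPrimary (not_three_dvd_norm hw)
    refine ⟨⟨ξ * w, ?_, hξ⟩, Subtype.ext ?_⟩
    · rw [map_mul, isUnit_iff_norm_eq_one.1 ξ.isUnit, one_mul, hw]
    · exact Ideal.span_singleton_mul_left_unit ξ.isUnit w

/-- The primary associates of the `y_j` are the primary elements of norm `3 n + 1`. -/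
theorem exists_equiv_exponents {x : PrimesMod 1 → Eis}
    (hx : ∀ p, Algebra.norm ℤ (x p) = (p : ℕ)) {n : ℕ}
    (h : ∀ p : PrimesMod 2, Even (padicValNat p (3 * n + 1))) :
    ∃ (ξ : exponents n → Eisˣ) (e : exponents n ≃ PrimaryOfNorm n),
      ∀ j, (ξ j : Eis) * yElem x n j = e j := by
  have h1 : ∀ j : exponents n, ∃ ξ : Eisˣ, IsPrimary (ξ * yElem x n j) := fun j =>
    exists_unit_mul_isPrimary (not_three_dvd_norm (norm_yElem hx h j.2))
  choose ξ hξ using h1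
  let f : exponents n → PrimaryOfNorm n := fun j => ⟨ξ j * yElem x n j, by
    rw [map_mul, isUnit_iff_norm_eq_one.1 (ξ j).isUnit, one_mul, norm_yElem hx h j.2], hξ j⟩
  have hf : ∀ j : exponents n, Associated (yElem x n j) (f j : Eis) := fun j => ⟨ξ j, mul_comm _ _⟩
  refine ⟨ξ, Equiv.ofBijective f ⟨fun j k hjk => ?_, fun z => ?_⟩, fun j => rfl⟩
  · refine Subtype.ext (eq_of_associated_yElem hx h j.2 k.2 ((hf j).trans ?_))
    rw [hjk]
    exact (hf k).symm
  · obtain ⟨j, hj, hjz⟩ := exists_associated_yElem hx h z.2.1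
    exact ⟨⟨j, hj⟩, Subtype.ext ((f ⟨j, hj⟩).2.2.eq_of_associated z.2.2
      ((hf ⟨j, hj⟩).symm.trans hjz))⟩

theorem exists_norm_of_mem_solutions {n : ℕ} {w : ℤ × ℤ} (hw : w ∈ solutions (12 * n + 4)) :
    ∃ z : Eis, Algebra.norm ℤ z = ((3 * n + 1 : ℕ) : ℤ) := by
  have h : w.1 ^ 2 + 3 * w.2 ^ 2 = ((12 * n + 4 : ℕ) : ℤ) := hw
  have hpar : Even (w.1 + w.2) := by
    have h1 : Even (w.1 ^ 2 + 3 * w.2 ^ 2) := by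
      rw [h]
      exact ⟨6 * n + 2, by push_cast; ring⟩
    simpa [Int.even_add, Int.even_mul, Int.even_pow, show ¬ Even (3 : ℤ) by decide] using h1
  obtain ⟨a, ha⟩ := hpar
  refine ⟨eisMk a w.2, ?_⟩
  have hw1 : w.1 = 2 * a - w.2 := by linarith
  rw [hw1] at h
  rw [norm_eisMk]
  push_cast at h ⊢
  linarith

theorem solutions_nonempty_of_norm {n : ℕ} {z : Eis}
    (hz : Algebra.norm ℤ z = ((3 * n + 1 : ℕ) : ℤ)) : (solutions (12 * n + 4)).Nonempty := by
  obtain ⟨a, b, rfl⟩ := exists_eq_eisMk z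
  rw [norm_eisMk] at hz
  refine ⟨(2 * a - b, b), ?_⟩
  change (2 * a - b) ^ 2 + 3 * b ^ 2 = ((12 * n + 4 : ℕ) : ℤ)
  push_cast at hz ⊢
  linarith

theorem exists_primes_above (p : PrimesMod 1) :
    ∃ z : Eis, Irreducible z ∧ eisNorm z = ((p : ℕ) : Eis) := by
  obtain ⟨z, hz⟩ := exists_norm_eq_of_mod_eq_one p.2.1 p.2.2
  exact ⟨z, irreducible_of_norm_eq_prime p.2.1 hz, eisNorm_eq_natCast.2 hz⟩

end ThreeCore

theorem mainTheorem1 (n : ℕ) :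
    -- solvability criterion
    ((solutions (12 * n + 4)).Nonempty ↔
      ∀ p : PrimesMod 2, Even (padicValNat p (3 * n + 1))) ∧
    -- the map `ϑ : 𝓒_n → 𝓤_{12n+4}` is well defined and injective
    Set.MapsTo theta (charVecs n) (solutions (12 * n + 4)) ∧
    Set.InjOn theta (charVecs n) ∧
    -- elements `x_p` as used below exist
    (∀ p : PrimesMod 1, ∃ z : Eis, Irreducible z ∧ eisNorm z = ((p : ℕ) : Eis)) ∧
    -- in the solvable case, for every choice of the `x_p`: the description of `𝓒_n` by the `y_j`,
    -- the resulting bijection from `𝓥_n` to the 3-cores of `n`, and the number of 3-cores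
    ((∀ p : PrimesMod 2, Even (padicValNat p (3 * n + 1))) →
      (∀ x : PrimesMod 1 → Eis,
        (∀ p, Irreducible (x p) ∧ eisNorm (x p) = ((p : ℕ) : Eis)) →
        ∃ (ξ : exponents n → Eisˣ) (u v : exponents n → ℤ) (c : exponents n → ℤ × ℤ)
          (e : exponents n ≃ threeCores n),
          (∀ j, u j ≡ 1 [ZMOD 3] ∧ v j ≡ 1 [ZMOD 3] ∧
            (((ξ j : Eis) * yElem x n j : Eis) : ℂ) = rho (u j, v j)) ∧
          (∀ j, c j ∈ charVecs n ∧ theta (c j) = (u j, v j)) ∧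
          charVecs n = Set.range c ∧
          (∀ j, charVec (e j) = toTriple (c j))) ∧
      a3 n = ∏ᶠ p : PrimesMod 1, (padicValNat p (3 * n + 1) + 1)) ∧
    -- the bijection from the 3-cores of `n` to the normalized elements of norm `3n+1`
    (∃ e : threeCores n ≃ {z : Eis // eisNorm z = ((3 * n + 1 : ℕ) : Eis) ∧
          ∃ u v : ℤ, u ≡ 1 [ZMOD 3] ∧ v ≡ 1 [ZMOD 3] ∧ (z : ℂ) = rho (u, v)},
        ∀ μ : threeCores n, ∃ c : ℤ × ℤ, charVec μ = toTriple c ∧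
          ((e μ : Eis) : ℂ) = rho (theta c)) ∧
    -- the bijection from the 3-cores of `n` to the ideals of norm `3n+1`
    (∃ e : threeCores n ≃ {I : Ideal Eis // Nat.card (Eis ⧸ I) = 3 * n + 1},
        ∀ μ : threeCores n, ∃ (c : ℤ × ℤ) (z : Eis), charVec μ = toTriple c ∧
          (z : ℂ) = rho (theta c) ∧ (e μ : Ideal Eis) = Ideal.span {z}) := by
  obtain ⟨E, hE⟩ := exists_equiv_primaryOfNorm n
  choose d hd hcv hrho using hE
  obtain ⟨E', hE'⟩ := exists_equiv_ideals n
  choose x₀ hx₀ using exists_primes_above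
  have hnorm₀ : ∀ p, Algebra.norm ℤ (x₀ p) = (p : ℕ) := fun p => eisNorm_eq_natCast.1 (hx₀ p).2
  refine ⟨⟨?_, fun h => ?_⟩, ?_, theta_injective.injOn, exists_primes_above,
    fun h => ⟨fun x hx => ?_, ?_⟩, ?_, ?_⟩
  · rintro ⟨w, hw⟩ p
    obtain ⟨z, hz⟩ := exists_norm_of_mem_solutions hw
    exact even_padicValNat_of_norm_eq p.2.1 p.2.2 (Nat.succ_ne_zero _) hz
  · exact solutions_nonempty_of_norm (norm_yElem hnorm₀ h (j := 0) fun p => Nat.zero_le _)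
  · rw [charVecs_eq_latticePoints]
    exact fun c => theta_mem_solutions
  · obtain ⟨ξ, F, hF⟩ := exists_equiv_exponents (fun p => eisNorm_eq_natCast.1 (hx p).2) h
    let e : exponents n ≃ threeCores n := F.trans E.symm
    refine ⟨ξ, fun j => (theta (d (e j))).1, fun j => (theta (d (e j))).2, fun j => d (e j), e,
      fun j => ⟨?_, ?_, ?_⟩, fun j => ⟨?_, rfl⟩, ?_, fun j => hcv (e j)⟩
    · simp only [theta, Int.ModEq]
      omega
    · simp only [theta, Int.ModEq]
      omega
    · rw [hF, Prod.mk.eta, ← hrho, Equiv.trans_apply, Equiv.apply_symm_apply]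
    · rw [charVecs_eq_latticePoints]
      exact hd _
    · refine Set.Subset.antisymm ?_ ?_
      · rintro c ⟨μ, hμ, hc⟩
        refine ⟨e.symm ⟨μ, hμ⟩, toTriple_injective ?_⟩
        simp only
        rw [← hcv, Equiv.apply_symm_apply, ← hc]
      · rintro _ ⟨j, rfl⟩
        rw [charVecs_eq_latticePoints]
        exact hd _
  · obtain ⟨-, F, -⟩ := exists_equiv_exponents hnorm₀ h
    rw [a3, ← Nat.card_coe_set_eq, ← Nat.card_congr (F.trans E.symm), card_exponents]
  · refine ⟨E.trans (Equiv.subtypeEquivRight fun z => ?_), fun μ => ⟨d μ, hcv μ, hrho μ⟩⟩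
    rw [eisNorm_eq_natCast, isPrimary_iff]
  · exact ⟨E.trans E', fun μ => ⟨d μ, E μ, hcv μ, hrho μ, hE' _⟩⟩
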